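/- Let $G$ be a finite group. A $G$-Mackey functor $\underline N$ assigns to every finite $G$-set $X$ an abelian group $\underline N(X)$ and to every $G$-map $f\colon X\to Y$ a restriction $f^*\colon\underline N(Y)\to\underline N(X)$ and a transfer $f_*\colon\underline N(X)\to\underline N(Y)$, contravariantly respectively covariantly functorial, such that $g^*f_*=q_*p^*$ for every pullback square with $f p=g q$ and such that $\underline N$ sends finite disjoint unions to products (via restrictions). Let $\mathrm{Mack}_G$ be the category of $G$-Mackey functors, with the box product $\Box$, where $(\underline M\,\Box\,\underline N)(X)$ is the quotient of $\bigoplus_{f\colon Y\to X}\underline M(Y)\otimes\underline N(Y)$ by the Frobenius relations $h_*m\otimes n\sim m\otimes h^*n$ and $m\otimes h_*n\sim h^*m\otimes n$ for $G$-maps $h$ over $X$. The unit is the Burnside Mackey functor $\underline{\mathcal A}_G$, whose value $\underline{\mathcal A}_G(X)$ is the Grothendieck group of finite $G$-sets over $X$; so $\underline{\mathcal A}_G(G/H)=A(H)$ is the Burnside ring of $H$, and $A(G)=\underline{\mathcal A}_G(G/G)$. Let $\mathrm{Pic}(A(G))$ be the group of isomorphism classes of invertible $A(G)$-modules under $\otimes_{A(G)}$,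 and $\mathrm{Pic}(\mathrm{Mack}_G)$ the group of isomorphism classes of $\Box$-invertible $G$-Mackey functors under $\Box$. Let $F\colon\mathrm{Mod}_{A(G)}\to\mathrm{Mack}_G$ be the functor $F(M)(X)=\underline{\mathcal A}_G(X)\otimes_{A(G)}M$, so that $F(M)(G/H)=A(H)\otimes_{A(G)}M$, with restrictions and transfers induced from those of $\underline{\mathcal A}_G$, and let $U\colon\mathrm{Mack}_G\to\mathrm{Mod}_{A(G)}$ be the functor $U(\underline N)=\underline N(G/G)$, where for a finite $G$-set $Y$ with projection $\pi\colon Y\to G/G$ the class $[Y]$ acts as $\pi_*\pi^*$ (so $[G/H]\cdot x=\mathrm{tr}_H^G(R_H^G(x))$). Then $F$ is left adjoint to $U$; the functors $F$ and $U$ send invertible objects to invertible objects; and $[M]\mapsto[F(M)]$ and $[\underline N]\mapsto[U(\underline N)]$ are mutually inverse group isomorphisms $$\mathrm{Pic}(A(G))\;\cong\;\mathrm{Pic}(\mathrm{Mack}_G).$$ -/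

import Mathlib

open CategoryTheory Limits
open scoped TensorProduct

universe u

noncomputable section

/-- `X` is the coproduct of `A` and `B` along the inclusions `i` and `j`. -/
def IsCoprod {C : Type (u + 1)} [Category.{u} C] {A B X : C} (i : A ⟶ X) (j : B ⟶ X) : Prop :=
  Nonempty (IsColimit (BinaryCofan.mk i j))

/-- A Mackey functor on a category `C` (for us: the category of finite `G`-sets), in the sense of
Dress: a contravariant functor (restrictions) and a covariant functor (transfers) to abelian groups
with the same values on objects, which satisfy the base change formula for pullback squares (this is
the double coset formula) and send finite coproducts to products. -/
structure MackeyFunctor (C : Type (u + 1)) [Category.{u} C] where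
  obj : C → Type (u + 1)
  [grp : ∀ X, AddCommGroup (obj X)]
  res : ∀ {X Y : C}, (X ⟶ Y) → (obj Y →+ obj X)
  tr : ∀ {X Y : C}, (X ⟶ Y) → (obj X →+ obj Y)
  res_id : ∀ (X : C) (x : obj X), res (𝟙 X) x = x
  res_comp : ∀ {X Y Z : C} (f : X ⟶ Y) (g : Y ⟶ Z) (x : obj Z), res (f ≫ g) x = res f (res g x)
  tr_id : ∀ (X : C) (x : obj X), tr (𝟙 X) x = x
  tr_comp : ∀ {X Y Z : C} (f : X ⟶ Y) (g : Y ⟶ Z) (x : obj X), tr (f ≫ g) x = tr g (tr f x)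
  base_change : ∀ {P X Y Z : C} {p : P ⟶ X} {q : P ⟶ Y} {f : X ⟶ Z} {g : Y ⟶ Z},
    IsPullback p q f g → ∀ x : obj X, res g (tr f x) = tr q (res p x)
  subsingleton_of_isInitial : ∀ {X : C}, IsInitial X → Subsingleton (obj X)
  bijective_of_isCoprod : ∀ {A B X : C} {i : A ⟶ X} {j : B ⟶ X}, IsCoprod i j →
    Function.Bijective (fun x : obj X => (res i x, res j x))

namespace MackeyFunctor

attribute [instance] MackeyFunctor.grp

section Basic

variable {C : Type (u + 1)} [Category.{u} C]

/-- A morphism of Mackey functors: additive maps that commute with restrictions and transfers. -/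
@[ext]
structure Hom (M N : MackeyFunctor C) where
  app : ∀ X : C, M.obj X →+ N.obj X
  app_res : ∀ {X Y : C} (f : X ⟶ Y) (x : M.obj Y), app X (M.res f x) = N.res f (app Y x)
  app_tr : ∀ {X Y : C} (f : X ⟶ Y) (x : M.obj X), app Y (M.tr f x) = N.tr f (app X x)

instance : Category (MackeyFunctor C) where
  Hom M N := Hom M N
  id M := { app := fun X => AddMonoidHom.id _, app_res := fun _ _ => rfl, app_tr := fun _ _ => rfl }
  comp φ ψ :=
    { app := fun X => (ψ.app X).comp (φ.app X)
      app_res := fun f x => by simp [φ.app_res, ψ.app_res]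
      app_tr := fun f x => by simp [φ.app_tr, ψ.app_tr] }

@[simp] lemma id_app (M : MackeyFunctor C) (X : C) (x : M.obj X) :
    Hom.app (𝟙 M) X x = x := rfl

@[simp] lemma comp_app {M N P : MackeyFunctor C} (φ : M ⟶ N) (ψ : N ⟶ P) (X : C) (x : M.obj X) :
    Hom.app (φ ≫ ψ) X x = ψ.app X (φ.app X x) := rfl

lemma hom_ext {M N : MackeyFunctor C} {φ ψ : M ⟶ N} (h : ∀ X x, φ.app X x = ψ.app X x) : φ = ψ :=
  Hom.ext (funext fun X => AddMonoidHom.ext (h X))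

/-- A morphism of Mackey functors with objectwise inverses is an isomorphism. -/
def isoOfInv {M N : MackeyFunctor C} (φ : M ⟶ N) (ψ : ∀ X, N.obj X → M.obj X)
    (h₁ : ∀ X x, ψ X (φ.app X x) = x) (h₂ : ∀ X x, φ.app X (ψ X x) = x) : M ≅ N where
  hom := φ
  inv :=
    { app := fun X => AddMonoidHom.mk' (ψ X) fun a b => by
        rw [← h₁ X (ψ X a + ψ X b), map_add, h₂, h₂]
      app_res := fun {X Y} f x => by
        simp only [AddMonoidHom.mk'_apply]
        rw [← h₁ X (M.res f _), φ.app_res, h₂]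
      app_tr := fun {X Y} f x => by
        simp only [AddMonoidHom.mk'_apply]
        rw [← h₁ Y (M.tr f _), φ.app_tr, h₂] }
  hom_inv_id := hom_ext fun X x => h₁ X x
  inv_hom_id := hom_ext fun X x => h₂ X x

lemma iso_hom_inv {M N : MackeyFunctor C} (e : M ≅ N) (X : C) (x : M.obj X) :
    e.inv.app X (e.hom.app X x) = x := by
  rw [← comp_app, e.hom_inv_id, id_app]

lemma iso_inv_hom {M N : MackeyFunctor C} (e : M ≅ N) (X : C) (x : N.obj X) :
    e.hom.app X (e.inv.app X x) = x := by
  rw [← comp_app, e.inv_hom_id, id_app]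

lemma tr_res_of_iso (M : MackeyFunctor C) {X Y : C} (e : X ≅ Y) (y : M.obj Y) :
    M.tr e.hom (M.res e.hom y) = y := by
  have h : IsPullback e.inv (𝟙 Y) e.hom (𝟙 Y) := IsPullback.of_vert_isIso ⟨by simp⟩
  have := M.base_change h (M.res e.hom y)
  rw [M.res_id, M.tr_id, ← M.res_comp, e.inv_hom_id, M.res_id] at this
  exact this

lemma isCoprod_symm {A B X : C} {i : A ⟶ X} {j : B ⟶ X} (h : IsCoprod i j) : IsCoprod j i :=
  ⟨BinaryCofan.isColimitFlip h.some⟩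

end Basic

section Extensive

variable {C : Type (u + 1)} [Category.{u} C] [FinitaryExtensive C]

lemma isPullback_self_left {A B X : C} {i : A ⟶ X} {j : B ⟶ X} (h : IsCoprod i j) :
    IsPullback (𝟙 A) (𝟙 A) i i := by
  have : Mono i := FinitaryExtensive.mono_inl_of_isColimit h.some
  exact IsKernelPair.id_of_mono i

/-- Coproducts are stable under pullback. -/
lemma isCoprod_of_isPullback {A B X A' B' X' : C} {i : A ⟶ X} {j : B ⟶ X} (h : IsCoprod i j)
    {g : X' ⟶ X} {i' : A' ⟶ X'} {a : A' ⟶ A} {j' : B' ⟶ X'} {b : B' ⟶ B}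
    (hi : IsPullback i' a g i) (hj : IsPullback j' b g j) : IsCoprod i' j' :=
  ((BinaryCofan.isVanKampen_iff _).1 (FinitaryExtensive.vanKampen _ h.some)
    (BinaryCofan.mk i' j') a b g hi.w.symm hj.w.symm).2 ⟨hi, hj⟩

/-- To construct a Mackey functor, additivity may be checked in the form
`tr i ∘ res i + tr j ∘ res j = id`. -/
@[reducible]
def ofSum (obj : C → Type (u + 1)) [grp : ∀ X, AddCommGroup (obj X)]
    (res : ∀ {X Y : C}, (X ⟶ Y) → (obj Y →+ obj X))
    (tr : ∀ {X Y : C}, (X ⟶ Y) → (obj X →+ obj Y))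
    (res_id : ∀ (X : C) (x : obj X), res (𝟙 X) x = x)
    (res_comp : ∀ {X Y Z : C} (f : X ⟶ Y) (g : Y ⟶ Z) (x : obj Z),
      res (f ≫ g) x = res f (res g x))
    (tr_id : ∀ (X : C) (x : obj X), tr (𝟙 X) x = x)
    (tr_comp : ∀ {X Y Z : C} (f : X ⟶ Y) (g : Y ⟶ Z) (x : obj X),
      tr (f ≫ g) x = tr g (tr f x))
    (base_change : ∀ {P X Y Z : C} {p : P ⟶ X} {q : P ⟶ Y} {f : X ⟶ Z} {g : Y ⟶ Z},
      IsPullback p q f g → ∀ x : obj X, res g (tr f x) = tr q (res p x))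
    (subsingleton_of_isInitial : ∀ {X : C}, IsInitial X → Subsingleton (obj X))
    (sum : ∀ {A B X : C} {i : A ⟶ X} {j : B ⟶ X}, IsCoprod i j →
      ∀ x, tr i (res i x) + tr j (res j x) = x) : MackeyFunctor C where
  obj := obj
  res := res
  tr := tr
  res_id := res_id
  res_comp := res_comp
  tr_id := tr_id
  tr_comp := tr_comp
  base_change := base_change
  subsingleton_of_isInitial := subsingleton_of_isInitial
  bijective_of_isCoprod := by
    intro A B X i j h
    have self : ∀ {A B : C} {i : A ⟶ X} {j : B ⟶ X}, IsCoprod i j → ∀ a, res i (tr i a) = a := by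
      intro A B i j h a
      rw [base_change (isPullback_self_left h), res_id, tr_id]
    have cross : ∀ {A B : C} {i : A ⟶ X} {j : B ⟶ X}, IsCoprod i j → ∀ b, res i (tr j b) = 0 := by
      intro A B i j h b
      have hp : IsPullback (initial.to A) (initial.to B) i j :=
        FinitaryExtensive.isPullback_initial_to_binaryCofan h.some
      have := subsingleton_of_isInitial (initialIsInitial (C := C))
      rw [base_change hp.flip, Subsingleton.elim (res _ b) 0, map_zero]
    constructor
    · intro x y hxy
      obtain ⟨h1, h2⟩ := Prod.ext_iff.1 hxy
      simp only at h1 h2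
      rw [← sum h x, ← sum h y, h1, h2]
    · rintro ⟨a, b⟩
      refine ⟨tr i a + tr j b, ?_⟩
      simp [self h, cross h, self (isCoprod_symm h), cross (isCoprod_symm h)]

lemma sum_of_isCoprod (M : MackeyFunctor C) {A B X : C} {i : A ⟶ X} {j : B ⟶ X}
    (h : IsCoprod i j) (x : M.obj X) : M.tr i (M.res i x) + M.tr j (M.res j x) = x := by
  have self : ∀ {A B : C} {i : A ⟶ X} {j : B ⟶ X}, IsCoprod i j → ∀ a,
      M.res i (M.tr i a) = a := by
    intro A B i j h a
    rw [M.base_change (isPullback_self_left h), M.res_id, M.tr_id]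
  have cross : ∀ {A B : C} {i : A ⟶ X} {j : B ⟶ X}, IsCoprod i j → ∀ b,
      M.res i (M.tr j b) = 0 := by
    intro A B i j h b
    have hp : IsPullback (initial.to A) (initial.to B) i j :=
      FinitaryExtensive.isPullback_initial_to_binaryCofan h.some
    have := M.subsingleton_of_isInitial (initialIsInitial (C := C))
    rw [M.base_change hp.flip, Subsingleton.elim (M.res _ b) 0, map_zero]
  apply (M.bijective_of_isCoprod h).1
  simp [self h, cross h, self (isCoprod_symm h), cross (isCoprod_symm h)]

end Extensive

/-! ### The Burnside Mackey functor -/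

section Burnside

variable {C : Type (u + 1)} [Category.{u} C]

/-- The relations of the Grothendieck group of objects over `X`: isomorphic objects are identified,
and the class of a coproduct is the sum of the classes. -/
inductive BurnsideRel (X : C) : FreeAbelianGroup (Over X) → Prop
  | iso {Y Z : Over X} (e : Y ≅ Z) :
      BurnsideRel X (FreeAbelianGroup.of Y - FreeAbelianGroup.of Z)
  | coprod {A B Y : C} {i : A ⟶ Y} {j : B ⟶ Y} (h : IsCoprod i j) (f : Y ⟶ X) :
      BurnsideRel X (FreeAbelianGroup.of (Over.mk f) -
        (FreeAbelianGroup.of (Over.mk (i ≫ f)) + FreeAbelianGroup.of (Over.mk (j ≫ f))))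

/-- The Grothendieck group `A(X)` of objects over `X`. For the finite `G`-set `X = G/H` this is the
Burnside ring of `H`, since finite `G`-sets over `G/H` are equivalent to finite `H`-sets. -/
def BurnsideObj (X : C) : Type (u + 1) :=
  FreeAbelianGroup (Over X) ⧸ AddSubgroup.closure {z | BurnsideRel X z}

instance (X : C) : AddCommGroup (BurnsideObj X) :=
  inferInstanceAs (AddCommGroup
    (FreeAbelianGroup (Over X) ⧸ AddSubgroup.closure {z | BurnsideRel X z}))

/-- The class of an object over `X`. -/
def cls₀ {X Y : C} (f : Y ⟶ X) : BurnsideObj X :=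
  QuotientAddGroup.mk (FreeAbelianGroup.of (Over.mk f))

/-- Additive invariants of objects over `X` extend to the Grothendieck group. -/
def burnsideLift {X : C} {P : Type*} [AddCommGroup P] (φ : ∀ {Y : C}, (Y ⟶ X) → P)
    (hiso : ∀ {Y Z : C} (e : Y ≅ Z) (f : Z ⟶ X), φ (e.hom ≫ f) = φ f)
    (hcop : ∀ {A B Y : C} {i : A ⟶ Y} {j : B ⟶ Y}, IsCoprod i j → ∀ f : Y ⟶ X,
      φ f = φ (i ≫ f) + φ (j ≫ f)) : BurnsideObj X →+ P :=
  QuotientAddGroup.lift _ (FreeAbelianGroup.lift fun Y : Over X => φ Y.hom) (by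
    rw [AddSubgroup.closure_le]
    rintro z (⟨e⟩ | ⟨h, f⟩)
    · rename_i Y Z
      have := hiso ((Over.forget X).mapIso e) Z.hom
      simp only [Functor.mapIso_hom, Over.forget_map] at this
      simpa [sub_eq_zero] using this
    · simpa [sub_eq_zero] using hcop h f)

@[simp] lemma burnsideLift_cls₀ {X : C} {P : Type*} [AddCommGroup P] (φ : ∀ {Y : C}, (Y ⟶ X) → P)
    (hiso) (hcop) {Y : C} (f : Y ⟶ X) : burnsideLift φ hiso hcop (cls₀ f) = φ f :=
  FreeAbelianGroup.lift_apply_of _ _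

lemma cls₀_iso {X Y Z : C} (e : Y ≅ Z) (f : Z ⟶ X) : cls₀ (e.hom ≫ f) = cls₀ f := by
  have : BurnsideRel X _ := .iso (Over.isoMk e (by simp) : Over.mk (e.hom ≫ f) ≅ Over.mk f)
  exact (QuotientAddGroup.eq_iff_sub_mem).2 (AddSubgroup.subset_closure this)

lemma cls₀_coprod {X A B Y : C} {i : A ⟶ Y} {j : B ⟶ Y} (h : IsCoprod i j) (f : Y ⟶ X) :
    cls₀ f = cls₀ (i ≫ f) + cls₀ (j ≫ f) :=
  (QuotientAddGroup.eq_iff_sub_mem).2 (AddSubgroup.subset_closure (.coprod h f))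

lemma burnside_hom_ext {X : C} {P : Type*} [AddCommGroup P] {φ ψ : BurnsideObj X →+ P}
    (h : ∀ {Y : C} (f : Y ⟶ X), φ (cls₀ f) = ψ (cls₀ f)) : φ = ψ :=
  QuotientAddGroup.addMonoidHom_ext _ (FreeAbelianGroup.lift_ext _ _ (fun Y => h Y.hom))

lemma burnside_ext {X : C} {P : Type*} [AddCommGroup P] (φ ψ : BurnsideObj X →+ P)
    (h : ∀ {Y : C} (f : Y ⟶ X), φ (cls₀ f) = ψ (cls₀ f)) (a : BurnsideObj X) : φ a = ψ a :=
  DFunLike.congr_fun (burnside_hom_ext h) a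

/-- The transfer of the Burnside Mackey functor: composition. -/
def burnsideTr {X Y : C} (g : X ⟶ Y) : BurnsideObj X →+ BurnsideObj Y :=
  burnsideLift (fun f => cls₀ (f ≫ g))
    (fun e f => by rw [Category.assoc, cls₀_iso])
    (fun h f => by simp only [Category.assoc, ← cls₀_coprod h])

@[simp] lemma burnsideTr_cls₀ {X Y Z : C} (g : X ⟶ Y) (f : Z ⟶ X) :
    burnsideTr g (cls₀ f) = cls₀ (f ≫ g) := by simp [burnsideTr]

variable [HasPullbacks C]

lemma cls₀_snd_eq {X Y Z P : C} {p : P ⟶ Z} {q : P ⟶ X} {f : Z ⟶ Y} {g : X ⟶ Y}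
    (h : IsPullback p q f g) : cls₀ (pullback.snd f g) = cls₀ q := by
  rw [← h.isoPullback_hom_snd, cls₀_iso]

variable [FinitaryExtensive C]

/-- The restriction of the Burnside Mackey functor: pullback. -/
def burnsideRes {X Y : C} (g : X ⟶ Y) : BurnsideObj Y →+ BurnsideObj X :=
  burnsideLift (fun f => cls₀ (pullback.snd f g))
    (fun e f => cls₀_snd_eq (p := pullback.fst _ _ ≫ e.inv)
      (by
        exact IsPullback.of_iso (IsPullback.of_hasPullback f g) (Iso.refl _) e.symm (Iso.refl _)
          (Iso.refl _) (by simp) (by simp) (by simp) (by simp)))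
    (fun {A B Y'} i j h f => by
      have hi := IsPullback.of_hasPullback i (pullback.fst f g)
      have hj := IsPullback.of_hasPullback j (pullback.fst f g)
      have hc := IsPullback.of_hasPullback f g
      rw [cls₀_coprod (isCoprod_of_isPullback h hi.flip hj.flip) (pullback.snd f g),
        cls₀_snd_eq (hi.paste_vert hc), cls₀_snd_eq (hj.paste_vert hc)])

lemma burnsideRes_cls₀ {X Y Z P : C} {p : P ⟶ Z} {q : P ⟶ X} {f : Z ⟶ Y} {g : X ⟶ Y}
    (h : IsPullback p q f g) : burnsideRes g (cls₀ f) = cls₀ q := by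
  rw [burnsideRes, burnsideLift_cls₀, cls₀_snd_eq h]

/-- The Burnside Mackey functor `X ↦ A(X)`. -/
def burnside (C : Type (u + 1)) [Category.{u} C] [HasPullbacks C] [FinitaryExtensive C] :
    MackeyFunctor C :=
  ofSum BurnsideObj burnsideRes burnsideTr
    (fun X => burnside_ext _ (AddMonoidHom.id _) fun f => by
      simpa using burnsideRes_cls₀ (IsPullback.of_horiz_isIso (fst := 𝟙 _) ⟨by simp⟩ :
        IsPullback (𝟙 _) f f (𝟙 X)))
    (fun f g => burnside_ext _ ((burnsideRes f).comp (burnsideRes g)) fun k => by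
      have h1 := IsPullback.of_hasPullback k g
      have h2 := IsPullback.of_hasPullback (pullback.snd k g) f
      simpa [burnsideRes_cls₀ h1, burnsideRes_cls₀ h2] using
        burnsideRes_cls₀ (h2.flip.paste_vert h1.flip).flip)
    (fun X => burnside_ext _ (AddMonoidHom.id _) fun f => by simp)
    (fun f g => burnside_ext _ ((burnsideTr g).comp (burnsideTr f)) fun k => by simp)
    (fun {P X Y Z p q f g} h => burnside_ext ((burnsideRes g).comp (burnsideTr f))
        ((burnsideTr q).comp (burnsideRes p)) fun k => by
      have h1 := IsPullback.of_hasPullback k p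
      simp [burnsideRes_cls₀ h1, burnsideRes_cls₀ (h1.paste_vert h)])
    (fun {X} hX => by
      suffices h : ∀ a : BurnsideObj X, a = 0 from ⟨fun a b => (h a).trans (h b).symm⟩
      refine burnside_ext (AddMonoidHom.id _) 0 fun {Y} f => ?_
      have : IsIso f := hX.isIso_to f
      have hY : IsInitial Y := hX.ofIso (asIso f).symm
      have hc : IsCoprod (𝟙 Y) (𝟙 Y) := ⟨BinaryCofan.IsColimit.mk _ (fun _ _ => hY.to _)
        (fun _ _ => hY.hom_ext _ _) (fun _ _ => hY.hom_ext _ _)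
        (fun _ _ _ _ _ => hY.hom_ext _ _)⟩
      simpa using cls₀_coprod hc f)
    (fun {A B X i j} h => burnside_ext
        ((burnsideTr i).comp (burnsideRes i) + (burnsideTr j).comp (burnsideRes j))
        (AddMonoidHom.id _) fun k => by
      have hi := IsPullback.of_hasPullback k i
      have hj := IsPullback.of_hasPullback k j
      simp only [AddMonoidHom.add_apply, AddMonoidHom.comp_apply, burnsideRes_cls₀ hi,
        burnsideRes_cls₀ hj, burnsideTr_cls₀, AddMonoidHom.id_apply]
      rw [← hi.w, ← hj.w]
      exact (cls₀_coprod (isCoprod_of_isPullback h hi hj) k).symm)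

/-- The class of `f : Y ⟶ X` in the value `A(X)` of the Burnside Mackey functor. -/
def cls {X Y : C} (f : Y ⟶ X) : (burnside C).obj X := cls₀ f

/-- Additive maps out of `A(X)` are determined by the classes of objects over `X`. -/
lemma burnside_ind {X : C} {P : Type*} [AddCommGroup P] (φ ψ : (burnside C).obj X →+ P)
    (h : ∀ {Y : C} (f : Y ⟶ X), φ (cls f) = ψ (cls f)) (a : (burnside C).obj X) : φ a = ψ a :=
  burnside_ext (X := X) φ ψ h a

lemma burnside_tr_cls {X Y Z : C} (g : X ⟶ Y) (f : Z ⟶ X) :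
    (burnside C).tr g (cls f) = (cls (f ≫ g)) :=
  burnsideTr_cls₀ g f

lemma burnside_res_cls {X Y Z P : C} {p : P ⟶ Z} {q : P ⟶ X} {f : Z ⟶ Y} {g : X ⟶ Y}
    (h : IsPullback p q f g) :
    (burnside C).res g (cls f) = (cls q) :=
  burnsideRes_cls₀ h

/-- The action of `A(X)` on the value `M(X)` of a Mackey functor: the class of `f : Y ⟶ X` acts as
`tr f ∘ res f`. -/
def act (M : MackeyFunctor C) (X : C) : (burnside C).obj X →+ M.obj X →+ M.obj X :=
  burnsideLift (fun f => (M.tr f).comp (M.res f))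
    (fun e f => by
      ext x
      simp [M.tr_comp, M.res_comp, tr_res_of_iso])
    (fun {A B Y i j} h f => by
      ext x
      simp only [AddMonoidHom.add_apply, AddMonoidHom.comp_apply, M.tr_comp, M.res_comp]
      rw [← map_add, sum_of_isCoprod M h])

lemma act_cls (M : MackeyFunctor C) {X Y : C} (f : Y ⟶ X) (x : M.obj X) :
    M.act X (cls f) x = M.tr f (M.res f x) := by
  exact DFunLike.congr_fun (burnsideLift_cls₀ (X := X) (fun f => (M.tr f).comp (M.res f)) _ _ f) x

lemma one_act (M : MackeyFunctor C) {X : C} (x : M.obj X) :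
    M.act X (cls (𝟙 X)) x = x := by
  rw [act_cls, M.res_id, M.tr_id]

lemma act_one_right {X : C} (a : (burnside C).obj X) :
    (burnside C).act X a (cls (𝟙 X)) = a := by
  refine burnside_ind (((burnside C).act X).flip (cls (𝟙 X)))
    (AddMonoidHom.id _) (fun f => ?_) a
  have h : IsPullback f (𝟙 _) (𝟙 X) f := IsPullback.of_vert_isIso ⟨by simp⟩
  simp only [AddMonoidHom.flip_apply, AddMonoidHom.id_apply]
  rw [act_cls, burnside_res_cls h, burnside_tr_cls, Category.id_comp]

lemma act_cls_cls {X Y Z P : C} {p : P ⟶ Y} {q : P ⟶ Z} {f : Y ⟶ X} {g : Z ⟶ X}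
    (h : IsPullback p q f g) :
    (burnside C).act X (cls f) (cls g) =
      (cls (p ≫ f)) := by
  rw [act_cls, burnside_res_cls h.flip, burnside_tr_cls]

lemma act_comm {X : C} (a b : (burnside C).obj X) :
    (burnside C).act X a b = (burnside C).act X b a := by
  refine DFunLike.congr_fun (f := (burnside C).act X a)
    (g := ((burnside C).act X).flip a) (AddMonoidHom.ext (burnside_ind _ _ fun g => ?_)) b
  refine burnside_ind (((burnside C).act X).flip (cls g))
    ((burnside C).act X (cls g)) (fun f => ?_) a
  have h := IsPullback.of_hasPullback f g
  simp only [AddMonoidHom.flip_apply]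
  rw [act_cls_cls h, act_cls_cls h.flip, h.w]

lemma act_act (M : MackeyFunctor C) {X : C} (a b : (burnside C).obj X) (x : M.obj X) :
    M.act X ((burnside C).act X a b) x = M.act X a (M.act X b x) := by
  refine DFunLike.congr_fun (f := ((M.act X).flip x).comp ((burnside C).act X a))
    (g := (M.act X a).comp ((M.act X).flip x)) (AddMonoidHom.ext (burnside_ind _ _ fun g => ?_)) b
  refine burnside_ind (((M.act X).flip x).comp (((burnside C).act X).flip (cls g)))
    ((M.act X).flip (M.act X (cls g) x)) (fun f => ?_) a
  have h := IsPullback.of_hasPullback f g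
  simp only [AddMonoidHom.flip_apply, AddMonoidHom.comp_apply]
  rw [act_cls_cls h, act_cls, act_cls, act_cls, M.base_change h.flip, M.tr_comp, ← M.res_comp,
    ← h.w, M.res_comp]

lemma res_act (M : MackeyFunctor C) {X Y : C} (g : X ⟶ Y) (a : (burnside C).obj Y) (x : M.obj Y) :
    M.res g (M.act Y a x) = M.act X ((burnside C).res g a) (M.res g x) := by
  refine burnside_ind ((M.res g).comp ((M.act Y).flip x))
    (((M.act X).flip (M.res g x)).comp ((burnside C).res g)) (fun f => ?_) a
  have h := IsPullback.of_hasPullback f g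
  simp only [AddMonoidHom.flip_apply, AddMonoidHom.comp_apply]
  rw [burnside_res_cls h, act_cls, act_cls, M.base_change h]
  simp only [← M.res_comp, h.w]

lemma tr_act_res (M : MackeyFunctor C) {X Y : C} (g : X ⟶ Y) (a : (burnside C).obj X)
    (y : M.obj Y) : M.tr g (M.act X a (M.res g y)) = M.act Y ((burnside C).tr g a) y := by
  refine burnside_ind ((M.tr g).comp ((M.act X).flip (M.res g y)))
    (((M.act Y).flip y).comp ((burnside C).tr g)) (fun f => ?_) a
  simp only [AddMonoidHom.flip_apply, AddMonoidHom.comp_apply]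
  rw [burnside_tr_cls, act_cls, act_cls, M.tr_comp, M.res_comp]

lemma tr_res_act (M : MackeyFunctor C) {X Y : C} (g : X ⟶ Y) (a : (burnside C).obj Y)
    (x : M.obj X) : M.tr g (M.act X ((burnside C).res g a) x) = M.act Y a (M.tr g x) := by
  refine burnside_ind ((M.tr g).comp (((M.act X).flip x).comp ((burnside C).res g)))
    ((M.act Y).flip (M.tr g x)) (fun f => ?_) a
  have h := IsPullback.of_hasPullback f g
  simp only [AddMonoidHom.flip_apply, AddMonoidHom.comp_apply]
  rw [burnside_res_cls h, act_cls, act_cls, M.base_change h.flip, ← M.tr_comp, ← M.tr_comp, h.w]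

lemma hom_act {M N : MackeyFunctor C} (φ : M ⟶ N) {X : C} (a : (burnside C).obj X) (x : M.obj X) :
    φ.app X (M.act X a x) = N.act X a (φ.app X x) := by
  refine burnside_ind ((φ.app X).comp ((M.act X).flip x)) ((N.act X).flip (φ.app X x))
    (fun f => ?_) a
  simp only [AddMonoidHom.flip_apply, AddMonoidHom.comp_apply]
  rw [act_cls, act_cls, φ.app_tr, φ.app_res]

variable [HasTerminal C]

/-- The Burnside ring of `C`: the Grothendieck group of `C`, that is, of objects over the terminal
object, with the product of objects as multiplication. For finite `G`-sets this is `A(G)`. -/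
def BurnsideRing (C : Type (u + 1)) [Category.{u} C] [HasPullbacks C] [FinitaryExtensive C]
    [HasTerminal C] : Type (u + 1) :=
  (burnside C).obj (⊤_ C)

instance : AddCommGroup (BurnsideRing C) :=
  inferInstanceAs (AddCommGroup ((burnside C).obj (⊤_ C)))

instance : CommRing (BurnsideRing C) where
  __ := (inferInstance : AddCommGroup (BurnsideRing C))
  mul a b := (burnside C).act (⊤_ C) a b
  one := (cls (𝟙 (⊤_ C)) : (burnside C).obj (⊤_ C))
  mul_assoc a b c := act_act (burnside C) a b c
  mul_comm a b := act_comm a b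
  one_mul a := one_act (burnside C) a
  mul_one a := act_one_right a
  zero_mul a := DFunLike.congr_fun (map_zero ((burnside C).act (⊤_ C))) a
  mul_zero a := map_zero ((burnside C).act (⊤_ C) a)
  left_distrib a b c := map_add ((burnside C).act (⊤_ C) a) b c
  right_distrib a b c := DFunLike.congr_fun (map_add ((burnside C).act (⊤_ C)) a b) c

/-- The restriction `A(G) = A(pt) → A(X)`. -/
def resTop (X : C) : BurnsideRing C →+ (burnside C).obj X :=
  (burnside C).res (terminal.from X)

lemma resTop_one (X : C) : resTop X (1 : BurnsideRing C) = (cls (𝟙 X)) :=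
  burnside_res_cls (IsPullback.of_vert_isIso ⟨by simp⟩ :
    IsPullback (terminal.from X) (𝟙 X) (𝟙 (⊤_ C)) (terminal.from X))

lemma resTop_mul (X : C) (a b : BurnsideRing C) :
    resTop X (a * b) = (burnside C).act X (resTop X a) (resTop X b) :=
  res_act (burnside C) (terminal.from X) a b

lemma res_resTop {X Y : C} (f : X ⟶ Y) (a : BurnsideRing C) :
    (burnside C).res f (resTop Y a) = resTop X a := by
  exact ((burnside C).res_comp f (terminal.from Y) a).symm.trans
    (congrArg (fun t => (burnside C).res t a) (terminal.comp_from f))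

/-- Every value `M(X)` of a Mackey functor is a module over the Burnside ring `A(G)`: an element of
`A(G)` is restricted to `A(X)`, where the class of `f : Y ⟶ X` acts as `tr f ∘ res f`. -/
instance instModule (M : MackeyFunctor C) (X : C) : Module (BurnsideRing C) (M.obj X) where
  smul a x := M.act X (resTop X a) x
  one_smul x := by
    change M.act X (resTop X 1) x = x
    rw [resTop_one, one_act]
  mul_smul a b x := by
    change M.act X (resTop X (a * b)) x = M.act X (resTop X a) (M.act X (resTop X b) x)
    rw [resTop_mul, act_act]
  smul_zero a := map_zero (M.act X (resTop X a))
  smul_add a x y := map_add (M.act X (resTop X a)) x y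
  add_smul a b x := by
    change M.act X (resTop X (a + b)) x = M.act X (resTop X a) x + M.act X (resTop X b) x
    rw [map_add, map_add, AddMonoidHom.add_apply]
  zero_smul x := by
    change M.act X (resTop X 0) x = 0
    rw [map_zero, map_zero, AddMonoidHom.zero_apply]

lemma smul_def (M : MackeyFunctor C) {X : C} (a : BurnsideRing C) (x : M.obj X) :
    a • x = M.act X (resTop X a) x := rfl

/-- At the terminal object `pt = G/G`, the class of `Y` acts as `tr ∘ res` along `Y ⟶ pt`. -/
lemma cls_smul (M : MackeyFunctor C) {Y : C} (f : Y ⟶ ⊤_ C) (x : M.obj (⊤_ C)) :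
    (show BurnsideRing C from cls f) • x = M.tr f (M.res f x) := by
  have h : terminal.from (⊤_ C) = 𝟙 _ := terminal.hom_ext _ _
  have h' : resTop (⊤_ C) (show BurnsideRing C from cls f) = cls f :=
    (congrArg (fun t => (burnside C).res t (cls f)) h).trans ((burnside C).res_id _ _)
  rw [smul_def, h', act_cls]

/-- Restriction as a linear map over the Burnside ring. -/
def resLin (M : MackeyFunctor C) {X Y : C} (f : X ⟶ Y) : M.obj Y →ₗ[BurnsideRing C] M.obj X where
  __ := M.res f
  map_smul' a y := by
    simp only [ZeroHom.toFun_eq_coe, AddMonoidHom.toZeroHom_coe, RingHom.id_apply]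
    rw [smul_def, smul_def, res_act, res_resTop]

/-- Transfer as a linear map over the Burnside ring. -/
def trLin (M : MackeyFunctor C) {X Y : C} (f : X ⟶ Y) : M.obj X →ₗ[BurnsideRing C] M.obj Y where
  __ := M.tr f
  map_smul' a y := by
    simp only [ZeroHom.toFun_eq_coe, AddMonoidHom.toZeroHom_coe, RingHom.id_apply]
    rw [smul_def, smul_def, ← tr_res_act, res_resTop]

/-- A component of a morphism of Mackey functors as a linear map over the Burnside ring. -/
def appLin {M N : MackeyFunctor C} (φ : M ⟶ N) (X : C) : M.obj X →ₗ[BurnsideRing C] N.obj X where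
  __ := φ.app X
  map_smul' a y := hom_act φ (resTop X a) y

/-- The functor `U : N ↦ N(G/G)` from Mackey functors to modules over the Burnside ring. -/
def U (C : Type (u + 1)) [Category.{u} C] [HasPullbacks C] [FinitaryExtensive C] [HasTerminal C] :
    MackeyFunctor C ⥤ ModuleCat.{u + 1} (BurnsideRing C) where
  obj N := ModuleCat.of (BurnsideRing C) (N.obj (⊤_ C))
  map φ := ModuleCat.ofHom (appLin φ (⊤_ C))
  map_id _ := rfl
  map_comp _ _ := rfl

/-- The Mackey functor `X ↦ A(X) ⊗ V` for a module `V` over the Burnside ring `A(G)`, with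
restrictions and transfers induced from those of the Burnside Mackey functor. -/
def freeObj (V : Type (u + 1)) [AddCommGroup V] [Module (BurnsideRing C) V] : MackeyFunctor C :=
  ofSum (fun X => (burnside C).obj X ⊗[BurnsideRing C] V)
    (fun f => (((burnside C).resLin f).rTensor V).toAddMonoidHom)
    (fun f => (((burnside C).trLin f).rTensor V).toAddMonoidHom)
    (fun X x => by
      have : (burnside C).resLin (𝟙 X) = LinearMap.id := LinearMap.ext ((burnside C).res_id X)
      simp [this])
    (fun f g x => by
      have : (burnside C).resLin (f ≫ g) = (burnside C).resLin f ∘ₗ (burnside C).resLin g :=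
        LinearMap.ext ((burnside C).res_comp f g)
      simp [this, LinearMap.rTensor_comp])
    (fun X x => by
      have : (burnside C).trLin (𝟙 X) = LinearMap.id := LinearMap.ext ((burnside C).tr_id X)
      simp [this])
    (fun f g x => by
      have : (burnside C).trLin (f ≫ g) = (burnside C).trLin g ∘ₗ (burnside C).trLin f :=
        LinearMap.ext ((burnside C).tr_comp f g)
      simp [this, LinearMap.rTensor_comp])
    (fun {P X Y Z p q f g} h x => by
      have : (burnside C).resLin g ∘ₗ (burnside C).trLin f =
          (burnside C).trLin q ∘ₗ (burnside C).resLin p :=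
        LinearMap.ext ((burnside C).base_change h)
      have := LinearMap.congr_fun (congrArg (LinearMap.rTensor V) this) x
      simpa [LinearMap.rTensor_comp] using this)
    (fun {X} hX => by
      have := (burnside C).subsingleton_of_isInitial hX
      have h0 : ∀ x : (burnside C).obj X ⊗[BurnsideRing C] V, x = 0 := fun x => by
        induction x with
        | zero => rfl
        | tmul a v => rw [Subsingleton.elim a 0, TensorProduct.zero_tmul]
        | add x y hx hy => rw [hx, hy, add_zero]
      exact ⟨fun x y => (h0 x).trans (h0 y).symm⟩)
    (fun {A B X i j} h x => by
      have : (burnside C).trLin i ∘ₗ (burnside C).resLin i +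
          (burnside C).trLin j ∘ₗ (burnside C).resLin j = LinearMap.id :=
        LinearMap.ext (sum_of_isCoprod (burnside C) h)
      have := LinearMap.congr_fun (congrArg (LinearMap.rTensor V) this) x
      simpa [LinearMap.rTensor_comp, LinearMap.rTensor_add] using this)

/-- The functor `F : V ↦ (X ↦ A(X) ⊗ V)` from modules over the Burnside ring to Mackey functors. -/
def F (C : Type (u + 1)) [Category.{u} C] [HasPullbacks C] [FinitaryExtensive C] [HasTerminal C] :
    ModuleCat.{u + 1} (BurnsideRing C) ⥤ MackeyFunctor C where
  obj V := freeObj V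
  map φ :=
    { app := fun X => (φ.hom.lTensor ((burnside C).obj X)).toAddMonoidHom
      app_res := fun _ x => LinearMap.congr_fun
        ((LinearMap.lTensor_comp_rTensor ..).trans (LinearMap.rTensor_comp_lTensor ..).symm) x
      app_tr := fun _ x => LinearMap.congr_fun
        ((LinearMap.lTensor_comp_rTensor ..).trans (LinearMap.rTensor_comp_lTensor ..).symm) x }
  map_id _ := hom_ext fun _ x => LinearMap.congr_fun (LinearMap.lTensor_id _ _) x
  map_comp _ _ := hom_ext fun _ x => LinearMap.congr_fun (LinearMap.lTensor_comp _ _ _) x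

end Burnside

/-! ### The box product -/

section Box

variable {C : Type (u + 1)} [Category.{u} C]

/-- Generators of the value at `X` of the box product of `M` and `N`. -/
structure BoxGen (M N : MackeyFunctor C) (X : C) where
  Y : C
  f : Y ⟶ X
  m : M.obj Y
  n : N.obj Y

/-- The relations of the box product: biadditivity and the Frobenius relations. -/
inductive BoxRel (M N : MackeyFunctor C) (X : C) : FreeAbelianGroup (BoxGen M N X) → Prop
  | add_left {Y : C} (f : Y ⟶ X) (m m' : M.obj Y) (n : N.obj Y) :
      BoxRel M N X (FreeAbelianGroup.of ⟨Y, f, m + m', n⟩ -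
        (FreeAbelianGroup.of ⟨Y, f, m, n⟩ + FreeAbelianGroup.of ⟨Y, f, m', n⟩))
  | add_right {Y : C} (f : Y ⟶ X) (m : M.obj Y) (n n' : N.obj Y) :
      BoxRel M N X (FreeAbelianGroup.of ⟨Y, f, m, n + n'⟩ -
        (FreeAbelianGroup.of ⟨Y, f, m, n⟩ + FreeAbelianGroup.of ⟨Y, f, m, n'⟩))
  | frob_left {Z Y : C} (h : Z ⟶ Y) (f : Y ⟶ X) (m : M.obj Z) (n : N.obj Y) :
      BoxRel M N X (FreeAbelianGroup.of ⟨Y, f, M.tr h m, n⟩ -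
        FreeAbelianGroup.of ⟨Z, h ≫ f, m, N.res h n⟩)
  | frob_right {Z Y : C} (h : Z ⟶ Y) (f : Y ⟶ X) (m : M.obj Y) (n : N.obj Z) :
      BoxRel M N X (FreeAbelianGroup.of ⟨Y, f, m, N.tr h n⟩ -
        FreeAbelianGroup.of ⟨Z, h ≫ f, M.res h m, n⟩)

/-- The value at `X` of the box product of `M` and `N`: the direct sum of the groups
`M(Y) ⊗ N(Y)` over all `f : Y ⟶ X`, modulo the Frobenius relations. -/
def BoxObj (M N : MackeyFunctor C) (X : C) : Type (u + 1) :=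
  FreeAbelianGroup (BoxGen M N X) ⧸ AddSubgroup.closure {z | BoxRel M N X z}

instance (M N : MackeyFunctor C) (X : C) : AddCommGroup (BoxObj M N X) :=
  inferInstanceAs (AddCommGroup
    (FreeAbelianGroup (BoxGen M N X) ⧸ AddSubgroup.closure {z | BoxRel M N X z}))

/-- The class of `m ⊗ n`, sitting over `f : Y ⟶ X`. -/
def boxMk₀ {M N : MackeyFunctor C} {X Y : C} (f : Y ⟶ X) (m : M.obj Y) (n : N.obj Y) :
    BoxObj M N X :=
  QuotientAddGroup.mk (FreeAbelianGroup.of ⟨Y, f, m, n⟩)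

/-- Additive maps out of the value at `X` of a box product. -/
def boxLift₀ {M N : MackeyFunctor C} {X : C} {P : Type*} [AddCommGroup P]
    (φ : ∀ {Y : C}, (Y ⟶ X) → M.obj Y → N.obj Y → P)
    (add_left : ∀ {Y : C} (f : Y ⟶ X) m m' n, φ f (m + m') n = φ f m n + φ f m' n)
    (add_right : ∀ {Y : C} (f : Y ⟶ X) m n n', φ f m (n + n') = φ f m n + φ f m n')
    (frob_left : ∀ {Z Y : C} (h : Z ⟶ Y) (f : Y ⟶ X) m n,
      φ f (M.tr h m) n = φ (h ≫ f) m (N.res h n))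
    (frob_right : ∀ {Z Y : C} (h : Z ⟶ Y) (f : Y ⟶ X) m n,
      φ f m (N.tr h n) = φ (h ≫ f) (M.res h m) n) : BoxObj M N X →+ P :=
  QuotientAddGroup.lift _ (FreeAbelianGroup.lift fun g : BoxGen M N X => φ g.f g.m g.n) (by
    rw [AddSubgroup.closure_le]
    rintro z (⟨f, m, m', n⟩ | ⟨f, m, n, n'⟩ | ⟨h, f, m, n⟩ | ⟨h, f, m, n⟩)
    · simpa [sub_eq_zero] using add_left f m m' n
    · simpa [sub_eq_zero] using add_right f m n n'
    · simpa [sub_eq_zero] using frob_left h f m n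
    · simpa [sub_eq_zero] using frob_right h f m n)

lemma boxLift₀_mk {M N : MackeyFunctor C} {X : C} {P : Type*} [AddCommGroup P]
    (φ : ∀ {Y : C}, (Y ⟶ X) → M.obj Y → N.obj Y → P) (h₁) (h₂) (h₃) (h₄) {Y : C} (f : Y ⟶ X)
    (m : M.obj Y) (n : N.obj Y) : boxLift₀ φ h₁ h₂ h₃ h₄ (boxMk₀ f m n) = φ f m n :=
  FreeAbelianGroup.lift_apply_of _ _

lemma boxMk₀_eq {M N : MackeyFunctor C} {X : C} {a b : FreeAbelianGroup (BoxGen M N X)}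
    (h : BoxRel M N X (a - b)) :
    (QuotientAddGroup.mk a : BoxObj M N X) = QuotientAddGroup.mk b :=
  (QuotientAddGroup.eq_iff_sub_mem).2 (AddSubgroup.subset_closure h)

lemma box_ext₀ {M N : MackeyFunctor C} {X : C} {P : Type*} [AddCommGroup P]
    (φ ψ : BoxObj M N X →+ P)
    (h : ∀ {Y : C} (f : Y ⟶ X) m n, φ (boxMk₀ f m n) = ψ (boxMk₀ f m n)) (z : BoxObj M N X) :
    φ z = ψ z :=
  DFunLike.congr_fun (QuotientAddGroup.addMonoidHom_ext _
    (FreeAbelianGroup.lift_ext _ _ (fun g => h g.f g.m g.n))) z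

/-- The transfer of the box product: composition. -/
def boxTr {M N : MackeyFunctor C} {X Y : C} (g : X ⟶ Y) : BoxObj M N X →+ BoxObj M N Y :=
  boxLift₀ (fun f m n => boxMk₀ (f ≫ g) m n)
    (fun f m m' n => boxMk₀_eq (.add_left _ m m' n))
    (fun f m n n' => boxMk₀_eq (.add_right _ m n n'))
    (fun h f m n => by rw [Category.assoc]; exact boxMk₀_eq (.frob_left h _ m n))
    (fun h f m n => by rw [Category.assoc]; exact boxMk₀_eq (.frob_right h _ m n))

lemma boxTr_mk {M N : MackeyFunctor C} {X Y Z : C} (g : X ⟶ Y) (f : Z ⟶ X) (m : M.obj Z)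
    (n : N.obj Z) : boxTr g (boxMk₀ f m n) = boxMk₀ (f ≫ g) m n :=
  boxLift₀_mk ..

/-- Generators over isomorphic objects. -/
lemma boxMk₀_iso {M N : MackeyFunctor C} {X Y Z : C} (e : Z ≅ Y) (f : Y ⟶ X) (m : M.obj Y)
    (n : N.obj Y) : boxMk₀ (e.hom ≫ f) (M.res e.hom m) (N.res e.hom n) = boxMk₀ f m n := by
  have : boxMk₀ f (M.tr e.hom (M.res e.hom m)) n = _ := boxMk₀_eq (.frob_left e.hom f _ n)
  rw [tr_res_of_iso] at this
  exact this.symm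

variable [HasPullbacks C]

lemma boxMk₀_snd_eq {M N : MackeyFunctor C} {X Y Z P : C} {p : P ⟶ Z} {q : P ⟶ X} {f : Z ⟶ Y}
    {g : X ⟶ Y} (h : IsPullback p q f g) (m : M.obj Z) (n : N.obj Z) :
    boxMk₀ (pullback.snd f g) (M.res (pullback.fst f g) m) (N.res (pullback.fst f g) n) =
      boxMk₀ q (M.res p m) (N.res p n) := by
  rw [← boxMk₀_iso h.isoPullback, ← M.res_comp, ← N.res_comp, h.isoPullback_hom_fst,
    h.isoPullback_hom_snd]

/-- The restriction of the box product: pullback. -/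
def boxRes {M N : MackeyFunctor C} {X Y : C} (g : X ⟶ Y) : BoxObj M N Y →+ BoxObj M N X :=
  boxLift₀ (fun f m n => boxMk₀ (pullback.snd f g) (M.res (pullback.fst f g) m)
      (N.res (pullback.fst f g) n))
    (fun f m m' n => by rw [map_add]; exact boxMk₀_eq (.add_left _ _ _ _))
    (fun f m n n' => by rw [map_add]; exact boxMk₀_eq (.add_right _ _ _ _))
    (fun h f m n => by
      have h1 := IsPullback.of_hasPullback f g
      have h2 := IsPullback.of_hasPullback h (pullback.fst f g)
      rw [boxMk₀_snd_eq (h2.paste_vert h1), M.base_change h2, ← N.res_comp, h2.w, N.res_comp]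
      exact boxMk₀_eq (.frob_left _ _ _ _))
    (fun h f m n => by
      have h1 := IsPullback.of_hasPullback f g
      have h2 := IsPullback.of_hasPullback h (pullback.fst f g)
      rw [boxMk₀_snd_eq (h2.paste_vert h1), N.base_change h2, ← M.res_comp, h2.w, M.res_comp]
      exact boxMk₀_eq (.frob_right _ _ _ _))

lemma boxRes_mk {M N : MackeyFunctor C} {X Y Z P : C} {p : P ⟶ Z} {q : P ⟶ X} {f : Z ⟶ Y}
    {g : X ⟶ Y} (h : IsPullback p q f g) (m : M.obj Z) (n : N.obj Z) :
    boxRes g (boxMk₀ f m n) = boxMk₀ q (M.res p m) (N.res p n) := by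
  rw [boxRes, boxLift₀_mk, boxMk₀_snd_eq h]

variable [FinitaryExtensive C]

/-- The box product of two Mackey functors. -/
def box (M N : MackeyFunctor C) : MackeyFunctor C :=
  ofSum (BoxObj M N) boxRes boxTr
    (fun X => box_ext₀ _ (AddMonoidHom.id _) fun f m n => by
      have h : IsPullback (𝟙 _) f f (𝟙 X) := IsPullback.of_horiz_isIso ⟨by simp⟩
      rw [boxRes_mk h, M.res_id, N.res_id, AddMonoidHom.id_apply])
    (fun f g => box_ext₀ _ ((boxRes f).comp (boxRes g)) fun k m n => by
      have h1 := IsPullback.of_hasPullback k g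
      have h2 := IsPullback.of_hasPullback (pullback.snd k g) f
      rw [AddMonoidHom.comp_apply, boxRes_mk h1, boxRes_mk h2,
        boxRes_mk (h2.flip.paste_vert h1.flip).flip, M.res_comp, N.res_comp])
    (fun X => box_ext₀ _ (AddMonoidHom.id _) fun f m n => by
      rw [boxTr_mk, Category.comp_id, AddMonoidHom.id_apply])
    (fun f g => box_ext₀ _ ((boxTr g).comp (boxTr f)) fun k m n => by
      rw [AddMonoidHom.comp_apply, boxTr_mk, boxTr_mk, boxTr_mk, Category.assoc])
    (fun {P X Y Z p q f g} h => box_ext₀ ((boxRes g).comp (boxTr f))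
        ((boxTr q).comp (boxRes p)) fun k m n => by
      have h1 := IsPullback.of_hasPullback k p
      rw [AddMonoidHom.comp_apply, AddMonoidHom.comp_apply, boxRes_mk h1, boxTr_mk, boxTr_mk,
        boxRes_mk (h1.paste_vert h)])
    (fun {X} hX => by
      suffices h : ∀ a : BoxObj M N X, a = 0 from ⟨fun a b => (h a).trans (h b).symm⟩
      refine box_ext₀ (AddMonoidHom.id _) 0 fun {Y} f m n => ?_
      have : IsIso f := hX.isIso_to f
      have hY : IsInitial Y := hX.ofIso (asIso f).symm
      have := M.subsingleton_of_isInitial hY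
      have h : boxMk₀ f (m + m) n = boxMk₀ f m n + boxMk₀ f m n :=
        boxMk₀_eq (.add_left f m m n)
      rw [Subsingleton.elim (m + m) m] at h
      simpa using h)
    (fun {A B X i j} h => box_ext₀ ((boxTr i).comp (boxRes i) + (boxTr j).comp (boxRes j))
        (AddMonoidHom.id _) fun k m n => by
      have hi := IsPullback.of_hasPullback k i
      have hj := IsPullback.of_hasPullback k j
      rw [AddMonoidHom.add_apply, AddMonoidHom.comp_apply, AddMonoidHom.comp_apply, boxRes_mk hi,
        boxRes_mk hj, boxTr_mk, boxTr_mk, AddMonoidHom.id_apply, ← hi.w, ← hj.w]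
      conv_rhs => rw [← sum_of_isCoprod M (isCoprod_of_isPullback h hi hj) m]
      refine Eq.trans ?_ (boxMk₀_eq (.add_left k _ _ n)).symm
      exact congrArg₂ (· + ·) (boxMk₀_eq (.frob_left _ k _ n)).symm
        (boxMk₀_eq (.frob_left _ k _ n)).symm)

/-- The class of `m ⊗ n`, sitting over `f : Y ⟶ X`, in the box product. -/
def boxMk {M N : MackeyFunctor C} {X Y : C} (f : Y ⟶ X) (m : M.obj Y) (n : N.obj Y) :
    (box M N).obj X := boxMk₀ f m n

section boxMk

variable {M N P : MackeyFunctor C} {X Y Z : C}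

lemma boxMk_add_left (f : Y ⟶ X) (m m' : M.obj Y) (n : N.obj Y) :
    boxMk f (m + m') n = boxMk f m n + boxMk f m' n := boxMk₀_eq (.add_left f m m' n)

lemma boxMk_add_right (f : Y ⟶ X) (m : M.obj Y) (n n' : N.obj Y) :
    boxMk f m (n + n') = boxMk f m n + boxMk f m n' := boxMk₀_eq (.add_right f m n n')

lemma boxMk_frob_left (h : Z ⟶ Y) (f : Y ⟶ X) (m : M.obj Z) (n : N.obj Y) :
    boxMk f (M.tr h m) n = boxMk (h ≫ f) m (N.res h n) := boxMk₀_eq (.frob_left h f m n)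

lemma boxMk_frob_right (h : Z ⟶ Y) (f : Y ⟶ X) (m : M.obj Y) (n : N.obj Z) :
    boxMk f m (N.tr h n) = boxMk (h ≫ f) (M.res h m) n := boxMk₀_eq (.frob_right h f m n)

lemma box_tr_mk (g : X ⟶ Y) (f : Z ⟶ X) (m : M.obj Z) (n : N.obj Z) :
    (box M N).tr g (boxMk f m n) = boxMk (f ≫ g) m n := boxTr_mk g f m n

lemma box_res_mk {Q : C} {p : Q ⟶ Z} {q : Q ⟶ X} {f : Z ⟶ Y} {g : X ⟶ Y}
    (h : IsPullback p q f g) (m : M.obj Z) (n : N.obj Z) :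
    (box M N).res g (boxMk f m n) = boxMk q (M.res p m) (N.res p n) := boxRes_mk h m n

lemma box_ind {A : Type*} [AddCommGroup A] (φ ψ : (box M N).obj X →+ A)
    (h : ∀ {Y : C} (f : Y ⟶ X) m n, φ (boxMk f m n) = ψ (boxMk f m n)) (z : (box M N).obj X) :
    φ z = ψ z := box_ext₀ (X := X) φ ψ h z

/-- Additive maps out of the value at `X` of a box product. -/
def boxLift {A : Type*} [AddCommGroup A]
    (φ : ∀ {Y : C}, (Y ⟶ X) → M.obj Y → N.obj Y → A)
    (add_left : ∀ {Y : C} (f : Y ⟶ X) m m' n, φ f (m + m') n = φ f m n + φ f m' n)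
    (add_right : ∀ {Y : C} (f : Y ⟶ X) m n n', φ f m (n + n') = φ f m n + φ f m n')
    (frob_left : ∀ {Z Y : C} (h : Z ⟶ Y) (f : Y ⟶ X) m n,
      φ f (M.tr h m) n = φ (h ≫ f) m (N.res h n))
    (frob_right : ∀ {Z Y : C} (h : Z ⟶ Y) (f : Y ⟶ X) m n,
      φ f m (N.tr h n) = φ (h ≫ f) (M.res h m) n) : (box M N).obj X →+ A :=
  boxLift₀ φ add_left add_right frob_left frob_right

lemma boxLift_mk {A : Type*} [AddCommGroup A]
    (φ : ∀ {Y : C}, (Y ⟶ X) → M.obj Y → N.obj Y → A) (h₁) (h₂) (h₃) (h₄) (f : Y ⟶ X)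
    (m : M.obj Y) (n : N.obj Y) : boxLift φ h₁ h₂ h₃ h₄ (boxMk f m n) = φ f m n :=
  FreeAbelianGroup.lift_apply_of _ _

/-- The components of the morphism induced by a Dress pairing. -/
def boxDescApp (θ : ∀ X : C, M.obj X →+ N.obj X →+ P.obj X)
    (frob_left : ∀ {X Y : C} (f : X ⟶ Y) m n, θ Y (M.tr f m) n = P.tr f (θ X m (N.res f n)))
    (frob_right : ∀ {X Y : C} (f : X ⟶ Y) m n, θ Y m (N.tr f n) = P.tr f (θ X (M.res f m) n))
    (X : C) : (box M N).obj X →+ P.obj X :=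
  boxLift (fun {Y} f m n => P.tr f (θ Y m n))
    (fun f m m' n => by simp) (fun f m n n' => by simp)
    (fun h f m n => by rw [frob_left, P.tr_comp])
    (fun h f m n => by rw [frob_right, P.tr_comp])

lemma boxDescApp_mk (θ : ∀ X : C, M.obj X →+ N.obj X →+ P.obj X) (h₁) (h₂) (f : Y ⟶ X)
    (m : M.obj Y) (n : N.obj Y) :
    boxDescApp θ h₁ h₂ X (boxMk f m n) = P.tr f (θ Y m n) := by
  rw [boxDescApp, boxLift_mk]

/-- A Dress pairing `M, N → P` induces a morphism from the box product of `M` and `N` to `P`. -/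
def boxDesc (θ : ∀ X : C, M.obj X →+ N.obj X →+ P.obj X)
    (res : ∀ {X Y : C} (f : X ⟶ Y) m n, P.res f (θ Y m n) = θ X (M.res f m) (N.res f n))
    (frob_left : ∀ {X Y : C} (f : X ⟶ Y) m n, θ Y (M.tr f m) n = P.tr f (θ X m (N.res f n)))
    (frob_right : ∀ {X Y : C} (f : X ⟶ Y) m n, θ Y m (N.tr f n) = P.tr f (θ X (M.res f m) n)) :
    box M N ⟶ P where
  app := boxDescApp θ frob_left frob_right
  app_res {X Y} g z := by
    refine box_ind ((boxDescApp θ frob_left frob_right X).comp ((box M N).res g))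
      ((P.res g).comp (boxDescApp θ frob_left frob_right Y)) (fun f m n => ?_) z
    have h := IsPullback.of_hasPullback f g
    simp only [AddMonoidHom.comp_apply]
    rw [box_res_mk h, boxDescApp_mk, boxDescApp_mk, P.base_change h, res]
  app_tr {X Y} g z := by
    refine box_ind ((boxDescApp θ frob_left frob_right Y).comp ((box M N).tr g))
      ((P.tr g).comp (boxDescApp θ frob_left frob_right X)) (fun f m n => ?_) z
    simp only [AddMonoidHom.comp_apply]
    rw [box_tr_mk, boxDescApp_mk, boxDescApp_mk, P.tr_comp]

lemma boxDesc_mk (θ : ∀ X : C, M.obj X →+ N.obj X →+ P.obj X) (h₁) (h₂) (h₃) (f : Y ⟶ X)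
    (m : M.obj Y) (n : N.obj Y) :
    (boxDesc θ h₁ h₂ h₃).app X (boxMk f m n) = P.tr f (θ Y m n) :=
  boxDescApp_mk θ h₂ h₃ f m n

/-- The universal pairing. -/
def boxPair (M N : MackeyFunctor C) (X : C) : M.obj X →+ N.obj X →+ (box M N).obj X :=
  AddMonoidHom.mk' (fun m => AddMonoidHom.mk' (fun n => boxMk (𝟙 X) m n)
      (fun _ _ => boxMk_add_right ..))
    (fun _ _ => AddMonoidHom.ext fun _ => boxMk_add_left ..)

lemma boxPair_apply (m : M.obj X) (n : N.obj X) : boxPair M N X m n = boxMk (𝟙 X) m n := rfl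

lemma tr_boxPair (f : Y ⟶ X) (m : M.obj Y) (n : N.obj Y) :
    (box M N).tr f (boxPair M N Y m n) = boxMk f m n := by
  rw [boxPair_apply, box_tr_mk, Category.id_comp]

lemma res_boxPair (f : Y ⟶ X) (m : M.obj X) (n : N.obj X) :
    (box M N).res f (boxPair M N X m n) = boxPair M N Y (M.res f m) (N.res f n) :=
  box_res_mk (IsPullback.of_vert_isIso ⟨by simp⟩) m n

lemma boxPair_tr_left (f : Y ⟶ X) (m : M.obj Y) (n : N.obj X) :
    boxPair M N X (M.tr f m) n = (box M N).tr f (boxPair M N Y m (N.res f n)) := by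
  rw [tr_boxPair, boxPair_apply, boxMk_frob_left, Category.comp_id]

lemma boxPair_tr_right (f : Y ⟶ X) (m : M.obj X) (n : N.obj Y) :
    boxPair M N X m (N.tr f n) = (box M N).tr f (boxPair M N Y (M.res f m) n) := by
  rw [tr_boxPair, boxPair_apply, boxMk_frob_right, Category.comp_id]

end boxMk

/-- The box product of two morphisms. -/
def boxMap {M M' N N' : MackeyFunctor C} (φ : M ⟶ M') (ψ : N ⟶ N') : box M N ⟶ box M' N' :=
  boxDesc (fun X => ((boxPair M' N' X).comp (φ.app X)).compl₂ (ψ.app X))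
    (fun f m n => by simp [res_boxPair, φ.app_res, ψ.app_res])
    (fun f m n => by simp [boxPair_tr_left, φ.app_tr, ψ.app_res])
    (fun f m n => by simp [boxPair_tr_right, φ.app_res, ψ.app_tr])

lemma boxMap_mk {M M' N N' : MackeyFunctor C} (φ : M ⟶ M') (ψ : N ⟶ N') {X Y : C} (f : Y ⟶ X)
    (m : M.obj Y) (n : N.obj Y) :
    (boxMap φ ψ).app X (boxMk f m n) = boxMk f (φ.app Y m) (ψ.app Y n) :=
  (boxDesc_mk ..).trans (tr_boxPair ..)

/-- The box product of two isomorphisms. -/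
def boxIso {M M' N N' : MackeyFunctor C} (e : M ≅ M') (e' : N ≅ N') : box M N ≅ box M' N' :=
  isoOfInv (boxMap e.hom e'.hom) (fun X => (boxMap e.inv e'.inv).app X)
    (fun X => box_ind (((boxMap e.inv e'.inv).app X).comp ((boxMap e.hom e'.hom).app X))
      (AddMonoidHom.id _) fun f m n => by
        rw [AddMonoidHom.comp_apply, boxMap_mk, boxMap_mk, iso_hom_inv, iso_hom_inv,
          AddMonoidHom.id_apply])
    (fun X => box_ind (((boxMap e.hom e'.hom).app X).comp ((boxMap e.inv e'.inv).app X))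
      (AddMonoidHom.id _) fun f m n => by
        rw [AddMonoidHom.comp_apply, boxMap_mk, boxMap_mk, iso_inv_hom, iso_inv_hom,
          AddMonoidHom.id_apply])

/-- The symmetry of the box product. -/
def boxSwap (M N : MackeyFunctor C) : box M N ⟶ box N M :=
  boxDesc (fun X => (boxPair N M X).flip) (fun f m n => res_boxPair f n m)
    (fun f m n => boxPair_tr_right f n m) (fun f m n => boxPair_tr_left f n m)

lemma boxSwap_mk {M N : MackeyFunctor C} {X Y : C} (f : Y ⟶ X) (m : M.obj Y) (n : N.obj Y) :
    (boxSwap M N).app X (boxMk f m n) = boxMk f n m :=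
  (boxDesc_mk ..).trans (tr_boxPair ..)

/-- The symmetry isomorphism of the box product. -/
def boxComm (M N : MackeyFunctor C) : box M N ≅ box N M :=
  isoOfInv (boxSwap M N) (fun X => (boxSwap N M).app X)
    (fun X => box_ind (((boxSwap N M).app X).comp ((boxSwap M N).app X))
      (AddMonoidHom.id _) fun f m n => by
        rw [AddMonoidHom.comp_apply, boxSwap_mk, boxSwap_mk, AddMonoidHom.id_apply])
    (fun X => box_ind (((boxSwap M N).app X).comp ((boxSwap N M).app X))
      (AddMonoidHom.id _) fun f m n => by
        rw [AddMonoidHom.comp_apply, boxSwap_mk, boxSwap_mk, AddMonoidHom.id_apply])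

/-- The unit isomorphism: the Burnside Mackey functor is the unit of the box product. -/
def boxUnit (M : MackeyFunctor C) : box (burnside C) M ≅ M :=
  isoOfInv (boxDesc (M.act) (res_act M) (fun f a x => (tr_act_res M f a x).symm)
      (fun f a x => (tr_res_act M f a x).symm))
    (fun X x => boxPair (burnside C) M X (cls (𝟙 X)) x)
    (fun X => box_ind ((boxPair (burnside C) M X (cls (𝟙 X))).comp (Hom.app _ X))
      (AddMonoidHom.id _) fun {Y} f a x => by
        have res_one : (burnside C).res f (cls (𝟙 X)) = cls (𝟙 Y) :=
          burnside_res_cls (IsPullback.of_vert_isIso ⟨by simp⟩ : IsPullback f (𝟙 Y) (𝟙 X) f)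
        rw [AddMonoidHom.comp_apply, boxDesc_mk, boxPair_tr_right, res_one, AddMonoidHom.id_apply,
          ← tr_boxPair]
        congr 1
        refine burnside_ind ((boxPair (burnside C) M Y (cls (𝟙 Y))).comp ((M.act Y).flip x))
          ((boxPair (burnside C) M Y).flip x) (fun {Z} g => ?_) a
        have res_one' : (burnside C).res g (cls (𝟙 Y)) = cls (𝟙 Z) :=
          burnside_res_cls (IsPullback.of_vert_isIso ⟨by simp⟩ : IsPullback g (𝟙 Z) (𝟙 Y) g)
        have tr_one : (burnside C).tr g (cls (𝟙 Z)) = cls g := by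
          rw [burnside_tr_cls, Category.id_comp]
        simp only [AddMonoidHom.comp_apply, AddMonoidHom.flip_apply]
        rw [act_cls, boxPair_tr_right, res_one', ← boxPair_tr_left, tr_one])
    (fun X x => by rw [boxPair_apply, boxDesc_mk, one_act, M.tr_id])

/-- For fixed `p`, the pairing `m, n ↦ m ⊗ (n ⊗ p)`. -/
def assocAux (M N P : MackeyFunctor C) (X : C) :
    (box M N).obj X →+ P.obj X →+ (box M (box N P)).obj X :=
  boxLift
    (fun {Y} f m n => ((box M (box N P)).tr f).comp
      ((boxPair M (box N P) Y m).comp ((boxPair N P Y n).comp (P.res f))))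
    (fun f m m' n => by ext p; simp)
    (fun f m n n' => by ext p; simp)
    (fun h f m n => by
      ext p
      simp only [AddMonoidHom.comp_apply]
      rw [boxPair_tr_left, res_boxPair, (box M (box N P)).tr_comp, P.res_comp])
    (fun h f m n => by
      ext p
      simp only [AddMonoidHom.comp_apply]
      rw [boxPair_tr_left, boxPair_tr_right, (box M (box N P)).tr_comp, P.res_comp])

lemma assocAux_mk {M N P : MackeyFunctor C} {X Y : C} (f : Y ⟶ X) (m : M.obj Y) (n : N.obj Y)
    (p : P.obj X) : assocAux M N P X (boxMk f m n) p =
      (box M (box N P)).tr f (boxPair M (box N P) Y m (boxPair N P Y n (P.res f p))) := by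
  rw [assocAux, boxLift_mk]
  rfl

lemma assocAux_pair {M N P : MackeyFunctor C} {X : C} (m : M.obj X) (n : N.obj X)
    (p : P.obj X) : assocAux M N P X (boxPair M N X m n) p =
      boxPair M (box N P) X m (boxPair N P X n p) := by
  rw [boxPair_apply, assocAux_mk, P.res_id, (box M (box N P)).tr_id]

lemma assocAux_res {M N P : MackeyFunctor C} {X Y : C} (g : X ⟶ Y) (z : (box M N).obj Y)
    (p : P.obj Y) : (box M (box N P)).res g (assocAux M N P Y z p) =
      assocAux M N P X ((box M N).res g z) (P.res g p) := by
  refine box_ind (((box M (box N P)).res g).comp ((assocAux M N P Y).flip p))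
    (((assocAux M N P X).flip (P.res g p)).comp ((box M N).res g)) (fun f m n => ?_) z
  have h := IsPullback.of_hasPullback f g
  simp only [AddMonoidHom.comp_apply, AddMonoidHom.flip_apply]
  rw [box_res_mk h, assocAux_mk, assocAux_mk, (box M (box N P)).base_change h, res_boxPair,
    res_boxPair, ← P.res_comp, ← P.res_comp, h.w]

lemma assocAux_tr_left {M N P : MackeyFunctor C} {X Y : C} (g : X ⟶ Y) (z : (box M N).obj X)
    (p : P.obj Y) : assocAux M N P Y ((box M N).tr g z) p =
      (box M (box N P)).tr g (assocAux M N P X z (P.res g p)) := by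
  refine box_ind (((assocAux M N P Y).flip p).comp ((box M N).tr g))
    (((box M (box N P)).tr g).comp ((assocAux M N P X).flip (P.res g p)))
    (fun f m n => ?_) z
  simp only [AddMonoidHom.comp_apply, AddMonoidHom.flip_apply]
  rw [box_tr_mk, assocAux_mk, assocAux_mk, (box M (box N P)).tr_comp, P.res_comp]

lemma assocAux_tr_right {M N P : MackeyFunctor C} {X Y : C} (g : X ⟶ Y) (z : (box M N).obj Y)
    (p : P.obj X) : assocAux M N P Y z (P.tr g p) =
      (box M (box N P)).tr g (assocAux M N P X ((box M N).res g z) p) := by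
  refine box_ind ((assocAux M N P Y).flip (P.tr g p))
    (((box M (box N P)).tr g).comp (((assocAux M N P X).flip p).comp ((box M N).res g)))
    (fun f m n => ?_) z
  have h := IsPullback.of_hasPullback f g
  simp only [AddMonoidHom.comp_apply, AddMonoidHom.flip_apply]
  rw [box_res_mk h, assocAux_mk, assocAux_mk, P.base_change h.flip, boxPair_tr_right,
    boxPair_tr_right, ← (box M (box N P)).tr_comp, ← (box M (box N P)).tr_comp, h.w]

/-- The associativity morphism `m ⊗ n ⊗ p ↦ m ⊗ (n ⊗ p)`. -/
def assocHom (M N P : MackeyFunctor C) : box (box M N) P ⟶ box M (box N P) :=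
  boxDesc (assocAux M N P) assocAux_res assocAux_tr_left assocAux_tr_right

lemma assocHom_pair {M N P : MackeyFunctor C} {X : C} (m : M.obj X) (n : N.obj X)
    (p : P.obj X) : (assocHom M N P).app X (boxPair _ _ X (boxPair _ _ X m n) p) =
      boxPair _ _ X m (boxPair _ _ X n p) := by
  rw [boxPair_apply (M := box M N), assocHom, boxDesc_mk, assocAux_pair, (box M (box N P)).tr_id]

lemma boxSwap_pair {M N : MackeyFunctor C} {X : C} (m : M.obj X) (n : N.obj X) :
    (boxSwap M N).app X (boxPair _ _ X m n) = boxPair _ _ X n m :=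
  boxSwap_mk ..

lemma boxMap_pair {M M' N N' : MackeyFunctor C} (φ : M ⟶ M') (ψ : N ⟶ N') {X : C}
    (m : M.obj X) (n : N.obj X) :
    (boxMap φ ψ).app X (boxPair _ _ X m n) = boxPair _ _ X (φ.app X m) (ψ.app X n) :=
  boxMap_mk ..

/-- The inverse of the associator. -/
def assocInv (M N P : MackeyFunctor C) : box M (box N P) ⟶ box (box M N) P :=
  boxSwap M (box N P) ≫ boxMap (boxSwap N P) (𝟙 M) ≫ assocHom P N M ≫
    boxSwap P (box N M) ≫ boxMap (boxSwap N M) (𝟙 P)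

lemma assocInv_pair {M N P : MackeyFunctor C} {X : C} (m : M.obj X) (n : N.obj X)
    (p : P.obj X) : (assocInv M N P).app X (boxPair _ _ X m (boxPair _ _ X n p)) =
      boxPair _ _ X (boxPair _ _ X m n) p := by
  simp only [assocInv, comp_app]
  rw [boxSwap_pair, boxMap_pair, boxSwap_pair, id_app, assocHom_pair, boxSwap_pair, boxMap_pair,
    boxSwap_pair, id_app]

/-- Morphisms out of a box product are determined by their values on pure tensors. -/
lemma box_hom_ext {M N Q : MackeyFunctor C} {φ ψ : box M N ⟶ Q}
    (h : ∀ X m n, φ.app X (boxPair M N X m n) = ψ.app X (boxPair M N X m n)) : φ = ψ :=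
  hom_ext fun X => box_ind _ _ fun {Y} f m n => by
    rw [← tr_boxPair, φ.app_tr, ψ.app_tr, h]

lemma box_hom_ext_left {M N P Q : MackeyFunctor C} {φ ψ : box (box M N) P ⟶ Q}
    (h : ∀ X m n p, φ.app X (boxPair _ _ X (boxPair M N X m n) p) =
      ψ.app X (boxPair _ _ X (boxPair M N X m n) p)) : φ = ψ :=
  box_hom_ext fun X z p => by
    refine box_ind ((φ.app X).comp ((boxPair (box M N) P X).flip p))
      ((ψ.app X).comp ((boxPair (box M N) P X).flip p)) (fun {Y} f m n => ?_) z
    simp only [AddMonoidHom.comp_apply, AddMonoidHom.flip_apply]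
    rw [← tr_boxPair, boxPair_tr_left, φ.app_tr, ψ.app_tr, h]

lemma box_hom_ext_right {M N P Q : MackeyFunctor C} {φ ψ : box M (box N P) ⟶ Q}
    (h : ∀ X m n p, φ.app X (boxPair _ _ X m (boxPair N P X n p)) =
      ψ.app X (boxPair _ _ X m (boxPair N P X n p))) : φ = ψ :=
  box_hom_ext fun X m z => by
    refine box_ind ((φ.app X).comp (boxPair M (box N P) X m))
      ((ψ.app X).comp (boxPair M (box N P) X m)) (fun {Y} f n p => ?_) z
    simp only [AddMonoidHom.comp_apply]
    rw [← tr_boxPair, boxPair_tr_right, φ.app_tr, ψ.app_tr, h]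

/-- The associativity isomorphism of the box product. -/
def boxAssoc (M N P : MackeyFunctor C) : box (box M N) P ≅ box M (box N P) where
  hom := assocHom M N P
  inv := assocInv M N P
  hom_inv_id := box_hom_ext_left fun X m n p => by
    rw [comp_app, assocHom_pair, assocInv_pair, id_app]
  inv_hom_id := box_hom_ext_right fun X m n p => by
    rw [comp_app, assocInv_pair, assocHom_pair, id_app]

end Box

/-! ### Picard groups -/

section Picard

/-- The isomorphism classes of Mackey functors. -/
def IsoClass (C : Type (u + 1)) [Category.{u} C] : Type (u + 2) :=
  Quotient (isIsomorphicSetoid (MackeyFunctor C))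

/-- The isomorphism class of a Mackey functor. -/
def isoClass {C : Type (u + 1)} [Category.{u} C] (M : MackeyFunctor C) : IsoClass C :=
  Quotient.mk (isIsomorphicSetoid (MackeyFunctor C)) M

variable {C : Type (u + 1)} [Category.{u} C]

lemma isoClass_eq_iff {M N : MackeyFunctor C} : isoClass M = isoClass N ↔ Nonempty (M ≅ N) :=
  Quotient.eq (r := isIsomorphicSetoid (MackeyFunctor C))

variable [HasPullbacks C] [FinitaryExtensive C]

/-- Isomorphism classes of Mackey functors form a commutative monoid under the box product, with
the class of the Burnside Mackey functor as unit. -/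
instance : CommMonoid (IsoClass C) where
  mul := Quotient.map₂ box fun _ _ ⟨e⟩ _ _ ⟨e'⟩ => ⟨boxIso e e'⟩
  one := isoClass (burnside C)
  mul_assoc := by
    rintro ⟨M⟩ ⟨N⟩ ⟨P⟩
    exact Quotient.sound ⟨boxAssoc M N P⟩
  mul_comm := by
    rintro ⟨M⟩ ⟨N⟩
    exact Quotient.sound ⟨boxComm M N⟩
  one_mul := by
    rintro ⟨M⟩
    exact Quotient.sound ⟨boxUnit M⟩
  mul_one := by
    rintro ⟨M⟩
    exact Quotient.sound ⟨boxComm M (burnside C) ≪≫ boxUnit M⟩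

lemma isoClass_mul (M N : MackeyFunctor C) : isoClass M * isoClass N = isoClass (box M N) := rfl

lemma isoClass_one : (1 : IsoClass C) = isoClass (burnside C) := rfl

end Picard

end MackeyFunctor

/-! ### Finite `G`-sets -/

/-- The category of finite `G`-sets. -/
abbrev FinGSet (G : Type u) [Group G] : Type (u + 1) := Action FintypeCat.{u} G

instance FinGSet.finitaryExtensive (G : Type u) [Group G] : FinitaryExtensive (FinGSet G) :=
  finitaryExtensive_of_preserves_and_reflects_isomorphism
    (Action.forget FintypeCat.{u} G ⋙ FintypeCat.incl)

/-- `G`-Mackey functors. -/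
abbrev Mack (G : Type u) [Group G] : Type (u + 2) := MackeyFunctor (FinGSet G)

/-- The Burnside ring `A(G)`: the Grothendieck ring of finite `G`-sets. -/
abbrev Burnside (G : Type u) [Group G] : Type (u + 1) := MackeyFunctor.BurnsideRing (FinGSet G)

/-- The Picard group `Pic(Mack_G)`: the group of isomorphism classes of `G`-Mackey functors that
are invertible under the box product. -/
abbrev PicMack (G : Type u) [Group G] : Type (u + 2) := (MackeyFunctor.IsoClass (FinGSet G))ˣ

end

/-! The functor `F` is strong monoidal (`freeBoxIso`, `freeSelfIso`), and the unit `V → U(F(V))` is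
an isomorphism because `A(G) ⊗ V = V`. So `F` induces an injective homomorphism on Picard groups
(`picHom`, `picHom_injective`). The content is surjectivity: given `e : N □ N' ≅ A`, the counit
`F(N(G/G)) → N` has to be an isomorphism and `N(G/G)` has to be invertible.

The isomorphism `e` gives pairings `⟨ , ⟩ : N(X) × N'(X) → A(X)`. Suppose that `1 = ∑ ⟨xᵢ, yᵢ⟩` in
`A(G)` with `xᵢ ∈ N(G/G)` and `yᵢ ∈ N'(G/G)`. Then `n ↦ ∑ ⟨n, res yᵢ⟩ ⊗ xᵢ` inverts the counit up to
an automorphism of `N`, which compares the two contractions of `N □ N' □ N` (`exists_twist`,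
`freeCounit_bijective`).

If no such sum exists, all products `⟨x, y⟩` lie in a maximal ideal `M` of `A(G)`. Take a largest
orbit `T = G/H` with `[T] ∉ M`. Modulo `M`, every class `[Y]` is then congruent to its mark `|Y^H|`
(`Detects.sub_mark_mem`); in particular `w = |Aut T|`, the mark of `[T]`, is not in `M`. Taking
marks of the pairing at `T` gives an integral form `B` on `N(T) × N'(T)` (`markForm`). If `Aut T`
acts trivially on one argument of `B`, then `⟨tr m, tr n⟩` has mark `w² B(m, n)`
(`mark_pairing_tr`), so all values of `B` lie in `M`. But `N □ N'` at `G/G` is generated by tensors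
over objects `X`, whose images under `e` have marks that are sums of values of `B`. As `e` is
surjective, this puts `1` in `M`, a contradiction (`Detects.exists_pairing_notMem`).

It remains to see that `Aut T` acts trivially (`mem_trivialAut`). The form `B` has rank one
(`markForm_mul`). For `a` of order a power of a prime `ℓ`, counting lifts modulo `ℓ` shows that `B`
is nonzero on some pair of `a`-invariant elements (`exists_markForm_ne_zero`). With rank one this
forces `B(am, n) = B(m, n)`. -/

noncomputable section

namespace MackeyFunctor

/-! ### Isomorphisms of Mackey functors -/

section Bijective

variable {C : Type (u + 1)} [Category.{u} C]

/-- A morphism of Mackey functors with bijective components is an isomorphism. -/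
def isoOfBijective {M N : MackeyFunctor C} (φ : M ⟶ N)
    (h : ∀ X, Function.Bijective (φ.app X)) : M ≅ N :=
  isoOfInv φ (fun X => (Equiv.ofBijective _ (h X)).symm)
    (fun X x => (Equiv.ofBijective _ (h X)).symm_apply_apply x)
    (fun X x => (Equiv.ofBijective _ (h X)).apply_symm_apply x)

lemma app_bijective {M N : MackeyFunctor C} (e : M ≅ N) (X : C) :
    Function.Bijective (e.hom.app X) :=
  Function.bijective_iff_has_inverse.2
    ⟨e.inv.app X, iso_hom_inv e X, iso_inv_hom e X⟩

end Bijective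

/-! ### The adjunction between `F` and `U` -/

section FreeForgetful

variable {C : Type (u + 1)} [Category.{u} C] [HasPullbacks C] [FinitaryExtensive C]

lemma burnside_res_one {X Y : C} (f : X ⟶ Y) : (burnside C).res f (cls (𝟙 Y)) = cls (𝟙 X) :=
  burnside_res_cls (IsPullback.of_vert_isIso ⟨by simp⟩ : IsPullback f (𝟙 X) (𝟙 Y) f)

lemma act_comm_apply (M : MackeyFunctor C) {X : C} (a b : (burnside C).obj X) (x : M.obj X) :
    M.act X a (M.act X b x) = M.act X b (M.act X a x) := by
  rw [← act_act, act_comm, act_act]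

/-- The action of `A(X)` can be moved across a pure tensor. -/
lemma boxPair_act_right (M N : MackeyFunctor C) {X : C} (a : (burnside C).obj X) (m : M.obj X)
    (n : N.obj X) : boxPair M N X m (N.act X a n) = boxPair M N X (M.act X a m) n := by
  refine burnside_ind ((boxPair M N X m).comp ((N.act X).flip n))
    (((boxPair M N X).flip n).comp ((M.act X).flip m)) (fun f => ?_) a
  simp only [AddMonoidHom.comp_apply, AddMonoidHom.flip_apply]
  rw [act_cls, act_cls, boxPair_tr_right, boxPair_tr_left]

lemma act_boxPair (M N : MackeyFunctor C) {X : C} (a : (burnside C).obj X) (m : M.obj X)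
    (n : N.obj X) : (box M N).act X a (boxPair M N X m n) = boxPair M N X (M.act X a m) n := by
  refine burnside_ind (((box M N).act X).flip (boxPair M N X m n))
    (((boxPair M N X).flip n).comp ((M.act X).flip m)) (fun f => ?_) a
  simp only [AddMonoidHom.comp_apply, AddMonoidHom.flip_apply]
  rw [act_cls, act_cls, res_boxPair, boxPair_tr_left]

variable [HasTerminal C]

/-- The identification of the Burnside ring with the value of the Burnside Mackey functor at the
terminal object. -/
def topEquiv : (burnside C).obj (⊤_ C) ≃+ BurnsideRing C := AddEquiv.refl _

lemma topEquiv_act (a b : (burnside C).obj (⊤_ C)) :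
    topEquiv ((burnside C).act (⊤_ C) a b) = topEquiv a * topEquiv b := rfl

lemma topEquiv_one : topEquiv (cls (𝟙 (⊤_ C))) = 1 := rfl

lemma resTop_topEquiv (a : (burnside C).obj (⊤_ C)) (X : C) :
    resTop X (topEquiv a) = (burnside C).res (terminal.from X) a := rfl

lemma topEquiv_smul (M : MackeyFunctor C) (a : (burnside C).obj (⊤_ C)) (x : M.obj (⊤_ C)) :
    topEquiv a • x = M.act (⊤_ C) a x := by
  rw [smul_def, resTop_topEquiv, terminal.hom_ext (terminal.from (⊤_ C)) (𝟙 _),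
    (burnside C).res_id]

/-- The action of `A(X)` on `M(X)` is bilinear over the Burnside ring. -/
def actLin (M : MackeyFunctor C) (X : C) :
    (burnside C).obj X →ₗ[BurnsideRing C] M.obj X →ₗ[BurnsideRing C] M.obj X :=
  LinearMap.mk₂ _ (fun a x => M.act X a x) (fun a b x => by simp) (fun r a x => by
    rw [smul_def, smul_def, act_act]) (fun a x y => by simp) (fun r a x => by
    rw [smul_def, smul_def, act_comm_apply])

variable {V W : Type (u + 1)} [AddCommGroup V] [Module (BurnsideRing C) V] [AddCommGroup W]
  [Module (BurnsideRing C) W] {X Y : C}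

/-- The pure tensor `a ⊗ v` in the value at `X` of the free Mackey functor on `V`. -/
def freeMk (a : (burnside C).obj X) (v : V) : (freeObj V : MackeyFunctor C).obj X :=
  a ⊗ₜ[BurnsideRing C] v

lemma freeMk_add_left (a b : (burnside C).obj X) (v : V) :
    freeMk (a + b) v = freeMk a v + freeMk b v := TensorProduct.add_tmul a b v

lemma freeMk_add_right (a : (burnside C).obj X) (v w : V) :
    freeMk a (v + w) = freeMk a v + freeMk a w := TensorProduct.tmul_add a v w

lemma freeMk_smul (r : BurnsideRing C) (a : (burnside C).obj X) (v : V) :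
    freeMk (r • a) v = freeMk a (r • v) := TensorProduct.smul_tmul r a v

lemma free_res_mk (f : X ⟶ Y) (a : (burnside C).obj Y) (v : V) :
    (freeObj V).res f (freeMk a v) = freeMk ((burnside C).res f a) v := rfl

lemma free_tr_mk (f : X ⟶ Y) (a : (burnside C).obj X) (v : V) :
    (freeObj V).tr f (freeMk a v) = freeMk ((burnside C).tr f a) v := rfl

/-- Additive maps out of a value of a free Mackey functor are determined on pure tensors. -/
lemma free_ind {P : Type*} [AddCommGroup P] (φ ψ : (freeObj V : MackeyFunctor C).obj X →+ P)
    (h : ∀ a v, φ (freeMk a v) = ψ (freeMk a v)) (z : (freeObj V : MackeyFunctor C).obj X) :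
    φ z = ψ z := by
  induction z using TensorProduct.induction_on with
  | zero => exact (map_zero φ).trans (map_zero ψ).symm
  | tmul a v => exact h a v
  | add y z hy hz => exact (map_add φ y z).trans ((congrArg₂ _ hy hz).trans (map_add ψ y z).symm)

/-- Additive maps out of a value of a free Mackey functor. -/
def freeLift {P : Type*} [AddCommGroup P] (φ : (burnside C).obj X →+ V →+ P)
    (h : ∀ (r : BurnsideRing C) a v, φ (r • a) v = φ a (r • v)) :
    (freeObj V : MackeyFunctor C).obj X →+ P :=
  TensorProduct.liftAddHom φ h

/-- The elements `1 ⊗ v` over the terminal object generate: for `f : Y ⟶ X`, the tensor `[f] ⊗ v` is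
the transfer along `f` of the restriction of `1 ⊗ v` to `Y`. -/
lemma free_hom_ext {N : MackeyFunctor C} {φ ψ : freeObj V ⟶ N}
    (h : ∀ v, φ.app (⊤_ C) (freeMk (cls (𝟙 _)) v) = ψ.app (⊤_ C) (freeMk (cls (𝟙 _)) v)) :
    φ = ψ := by
  refine hom_ext fun X => free_ind _ _ fun a v => ?_
  refine burnside_ind ((φ.app X).comp ((AddMonoidHom.mk' (fun a => freeMk a v)
      fun a b => freeMk_add_left a b v)))
    ((ψ.app X).comp ((AddMonoidHom.mk' (fun a => freeMk a v)
      fun a b => freeMk_add_left a b v))) (fun {Y} f => ?_) a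
  have hf : freeMk (cls f) v =
      (freeObj V).tr f ((freeObj V).res (terminal.from Y) (freeMk (cls (𝟙 _)) v)) := by
    rw [free_res_mk, free_tr_mk]
    refine congrArg (freeMk · v) ?_
    refine Eq.trans ?_ (congrArg ((burnside C).tr f) (resTop_one Y)).symm
    rw [burnside_tr_cls, Category.id_comp]
  simp only [AddMonoidHom.comp_apply, AddMonoidHom.mk'_apply]
  rw [hf, φ.app_tr, φ.app_res, ψ.app_tr, ψ.app_res, h]

lemma free_act (b a : (burnside C).obj X) (v : V) :
    (freeObj V).act X b (freeMk a v) = freeMk ((burnside C).act X b a) v := by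
  refine burnside_ind (((freeObj V).act X).flip (freeMk a v))
    ((AddMonoidHom.mk' (fun a => freeMk a v) fun a b => freeMk_add_left a b v).comp
      (((burnside C).act X).flip a)) (fun f => ?_) b
  simp only [AddMonoidHom.comp_apply, AddMonoidHom.flip_apply, AddMonoidHom.mk'_apply]
  rw [act_cls, act_cls, free_res_mk, free_tr_mk]

/-- The components of the morphism from a free Mackey functor to `N` induced by a linear map to
`N(G/G)`. -/
def freeDescApp (N : MackeyFunctor C) (f : V →ₗ[BurnsideRing C] N.obj (⊤_ C)) (X : C) :
    (freeObj V).obj X →+ N.obj X :=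
  freeLift ((N.act X).compl₂ ((N.res (terminal.from X)).comp f.toAddMonoidHom)) (fun r a v => by
    have h : N.res (terminal.from X) (r • f v) = r • N.res (terminal.from X) (f v) :=
      (N.resLin (terminal.from X)).map_smul r (f v)
    simp only [AddMonoidHom.compl₂_apply, AddMonoidHom.comp_apply, LinearMap.toAddMonoidHom_coe,
      map_smul, h]
    rw [smul_def, smul_def, act_act, act_comm_apply])

lemma freeDescApp_mk (N : MackeyFunctor C) (f : V →ₗ[BurnsideRing C] N.obj (⊤_ C))
    (a : (burnside C).obj X) (v : V) :
    freeDescApp N f X (freeMk a v) = N.act X a (N.res (terminal.from X) (f v)) := rfl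

/-- The morphism from a free Mackey functor to `N` induced by a linear map to `N(G/G)`. -/
def freeDesc (N : MackeyFunctor C) (f : V →ₗ[BurnsideRing C] N.obj (⊤_ C)) : freeObj V ⟶ N where
  app := freeDescApp N f
  app_res {X Y} g z := by
    refine free_ind ((freeDescApp N f X).comp ((freeObj V).res g))
      ((N.res g).comp (freeDescApp N f Y)) (fun a v => ?_) z
    simp only [AddMonoidHom.comp_apply, free_res_mk, freeDescApp_mk]
    rw [res_act, ← N.res_comp, terminal.comp_from]
  app_tr {X Y} g z := by
    refine free_ind ((freeDescApp N f Y).comp ((freeObj V).tr g))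
      ((N.tr g).comp (freeDescApp N f X)) (fun a v => ?_) z
    simp only [AddMonoidHom.comp_apply, free_tr_mk, freeDescApp_mk]
    rw [← tr_act_res, ← N.res_comp, terminal.comp_from]

lemma freeDesc_mk (N : MackeyFunctor C) (f : V →ₗ[BurnsideRing C] N.obj (⊤_ C))
    (a : (burnside C).obj X) (v : V) :
    (freeDesc N f).app X (freeMk a v) = N.act X a (N.res (terminal.from X) (f v)) := rfl

lemma freeMk_top (a : (burnside C).obj (⊤_ C)) (v : V) :
    freeMk (cls (𝟙 _)) (topEquiv a • v) = freeMk a v := by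
  rw [← freeMk_smul, topEquiv_smul, act_one_right]

/-- The scalar action as a map from the value at the terminal object of a free Mackey functor. -/
def freeUnitInv (V : Type (u + 1)) [AddCommGroup V] [Module (BurnsideRing C) V] :
    (freeObj V : MackeyFunctor C).obj (⊤_ C) →+ V :=
  freeLift (AddMonoidHom.mk' (fun a => (AddMonoidHom.mk' (fun v => topEquiv a • v)
      fun v w => smul_add _ v w))
      fun a b => AddMonoidHom.ext fun v => by simp [add_smul]) (fun r a v => by
    obtain ⟨r, rfl⟩ := topEquiv.surjective r
    simp only [AddMonoidHom.mk'_apply]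
    rw [topEquiv_smul, act_comm, topEquiv_act, mul_smul])

lemma freeUnitInv_mk (a : (burnside C).obj (⊤_ C)) (v : V) :
    freeUnitInv V (freeMk a v) = topEquiv a • v := rfl

/-- The unit `v ↦ 1 ⊗ v` of the adjunction, which is an isomorphism. -/
def freeUnit (V : Type (u + 1)) [AddCommGroup V] [Module (BurnsideRing C) V] :
    V ≃ₗ[BurnsideRing C] (freeObj V : MackeyFunctor C).obj (⊤_ C) where
  toFun v := freeMk (cls (𝟙 _)) v
  map_add' := freeMk_add_right _
  map_smul' r v := by
    obtain ⟨r, rfl⟩ := topEquiv.surjective r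
    rw [RingHom.id_apply, topEquiv_smul, free_act, act_one_right, freeMk_top]
  invFun := freeUnitInv V
  left_inv v := by rw [freeUnitInv_mk, topEquiv_one, one_smul]
  right_inv z := by
    refine free_ind ((AddMonoidHom.mk' (fun v => freeMk (cls (𝟙 _)) v)
      (freeMk_add_right _)).comp (freeUnitInv V)) (AddMonoidHom.id _) (fun a v => ?_) z
    simp only [AddMonoidHom.comp_apply, AddMonoidHom.mk'_apply, AddMonoidHom.id_apply]
    rw [freeUnitInv_mk, freeMk_top]

lemma freeUnit_apply (v : V) : freeUnit V v = freeMk (cls (𝟙 (⊤_ C))) v := rfl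

/-- The counit of the adjunction between `F` and `U`. -/
def freeCounit (N : MackeyFunctor C) : freeObj (N.obj (⊤_ C)) ⟶ N := freeDesc N LinearMap.id

lemma freeCounit_mk (N : MackeyFunctor C) (a : (burnside C).obj X) (x : N.obj (⊤_ C)) :
    (freeCounit N).app X (freeMk a x) = N.act X a (N.res (terminal.from X) x) := rfl

lemma freeCounit_one (N : MackeyFunctor C) (x : N.obj (⊤_ C)) :
    (freeCounit N).app (⊤_ C) (freeMk (cls (𝟙 _)) x) = x := by
  rw [freeCounit_mk, one_act, terminal.hom_ext (terminal.from (⊤_ C)) (𝟙 _), N.res_id]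

variable (C) in
/-- The functor `F` is left adjoint to `U`. -/
def adjFU : F C ⊣ U C where
  unit :=
    { app V := ModuleCat.ofHom (freeUnit V).toLinearMap
      naturality V W φ := rfl }
  counit :=
    { app N := freeCounit N
      naturality M N φ := free_hom_ext (V := M.obj (⊤_ C)) fun x => by
        refine ((freeCounit_one N _).trans ?_)
        exact (congrArg (φ.app _) (freeCounit_one M x)).symm }
  left_triangle_components V := free_hom_ext (V := V) fun v => freeCounit_one (freeObj V) _
  right_triangle_components N := ModuleCat.hom_ext (LinearMap.ext fun x => freeCounit_one N x)

end FreeForgetful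
-- `F` is strong monoidal and induces an injection on Picard groups
section FreeMonoidal

variable {C : Type (u + 1)} [Category.{u} C] [HasPullbacks C] [FinitaryExtensive C] [HasTerminal C]
variable {V W : Type (u + 1)} [AddCommGroup V] [Module (BurnsideRing C) V] [AddCommGroup W]
  [Module (BurnsideRing C) W] {X Y : C}

/-- The linear pairing underlying `freePair`. -/
def freePairLin (V W : Type (u + 1)) [AddCommGroup V] [Module (BurnsideRing C) V] [AddCommGroup W]
    [Module (BurnsideRing C) W] (X : C) :
    ((burnside C).obj X ⊗[BurnsideRing C] V) →ₗ[BurnsideRing C]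
      ((burnside C).obj X ⊗[BurnsideRing C] W) →ₗ[BurnsideRing C]
        ((burnside C).obj X ⊗[BurnsideRing C] (V ⊗[BurnsideRing C] W)) :=
  TensorProduct.curry ((LinearMap.rTensor (V ⊗[BurnsideRing C] W)
      (TensorProduct.lift (actLin (burnside C) X))) ∘ₗ
    (TensorProduct.tensorTensorTensorComm (BurnsideRing C) ((burnside C).obj X) V
      ((burnside C).obj X) W).toLinearMap)

/-- The pairing `(a ⊗ v, b ⊗ w) ↦ ab ⊗ (v ⊗ w)` of the values of two free Mackey functors. -/
def freePair (V W : Type (u + 1)) [AddCommGroup V] [Module (BurnsideRing C) V] [AddCommGroup W]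
    [Module (BurnsideRing C) W] (X : C) :
    (freeObj V).obj X →+ (freeObj W).obj X →+
      (freeObj (V ⊗[BurnsideRing C] W) : MackeyFunctor C).obj X :=
  AddMonoidHom.mk' (fun m => (freePairLin V W X m).toAddMonoidHom)
    (fun m m' => congrArg LinearMap.toAddMonoidHom (map_add (freePairLin V W X) m m'))

lemma freePair_mk (a b : (burnside C).obj X) (v : V) (w : W) :
    freePair V W X (freeMk a v) (freeMk b w) = freeMk ((burnside C).act X a b) (v ⊗ₜ w) := rfl

/-- Biadditive maps on free Mackey functors are determined on pure tensors. -/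
lemma free_ind₂ {P : Type*} [AddCommGroup P]
    (φ ψ : (freeObj V : MackeyFunctor C).obj X →+ (freeObj W : MackeyFunctor C).obj Y →+ P)
    (h : ∀ a v b w, φ (freeMk a v) (freeMk b w) = ψ (freeMk a v) (freeMk b w))
    (m : (freeObj V : MackeyFunctor C).obj X) (n : (freeObj W : MackeyFunctor C).obj Y) :
    φ m n = ψ m n :=
  DFunLike.congr_fun (free_ind φ ψ
    (fun a v => AddMonoidHom.ext (free_ind _ _ (fun b w => h a v b w))) m) n

lemma freePair_res (f : X ⟶ Y) (m : (freeObj V).obj Y) (n : (freeObj W).obj Y) :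
    (freeObj _).res f (freePair V W Y m n) =
      freePair V W X ((freeObj V).res f m) ((freeObj W).res f n) :=
  free_ind₂ ((freePair V W Y).compr₂ ((freeObj _).res f))
    (((freePair V W X).comp ((freeObj V).res f)).compl₂ ((freeObj W).res f))
    (fun a v b w => by
      simp only [AddMonoidHom.compr₂_apply, AddMonoidHom.compl₂_apply, AddMonoidHom.comp_apply,
        freePair_mk, free_res_mk, res_act]) m n

lemma freePair_tr_left (f : X ⟶ Y) (m : (freeObj V).obj X) (n : (freeObj W).obj Y) :
    freePair V W Y ((freeObj V).tr f m) n =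
      (freeObj _).tr f (freePair V W X m ((freeObj W).res f n)) :=
  free_ind₂ ((freePair V W Y).comp ((freeObj V).tr f))
    (((freePair V W X).compl₂ ((freeObj W).res f)).compr₂ ((freeObj _).tr f))
    (fun a v b w => by
      simp only [AddMonoidHom.compr₂_apply, AddMonoidHom.compl₂_apply, AddMonoidHom.comp_apply,
        freePair_mk, free_res_mk, free_tr_mk]
      -- Frobenius reciprocity is available for the acting factor restricted, so the transferred
      -- factor is first moved to the right by commutativity.
      rw [act_comm a, tr_res_act, act_comm]) m n

lemma freePair_tr_right (f : X ⟶ Y) (m : (freeObj V).obj Y) (n : (freeObj W).obj X) :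
    freePair V W Y m ((freeObj W).tr f n) =
      (freeObj _).tr f (freePair V W X ((freeObj V).res f m) n) :=
  free_ind₂ ((freePair V W Y).compl₂ ((freeObj W).tr f))
    (((freePair V W X).comp ((freeObj V).res f)).compr₂ ((freeObj _).tr f))
    (fun a v b w => by
      simp only [AddMonoidHom.compr₂_apply, AddMonoidHom.compl₂_apply, AddMonoidHom.comp_apply,
        freePair_mk, free_res_mk, free_tr_mk]
      rw [tr_res_act]) m n

/-- The morphism from the box product of free Mackey functors to the free Mackey functor on the
tensor product. -/
def freeBoxHom (V W : Type (u + 1)) [AddCommGroup V] [Module (BurnsideRing C) V] [AddCommGroup W]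
    [Module (BurnsideRing C) W] :
    box (freeObj V) (freeObj W) ⟶ (freeObj (V ⊗[BurnsideRing C] W) : MackeyFunctor C) :=
  boxDesc (freePair V W) freePair_res freePair_tr_left freePair_tr_right

lemma freeBoxHom_pair (a b : (burnside C).obj X) (v : V) (w : W) :
    (freeBoxHom V W).app X (boxPair _ _ X (freeMk a v) (freeMk b w)) =
      freeMk ((burnside C).act X a b) (v ⊗ₜ w) := by
  rw [boxPair_apply, freeBoxHom, boxDesc_mk, MackeyFunctor.tr_id, freePair_mk]

/-- The pairing on the values of a box product at the terminal object, as a linear map. -/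
def boxPairTop (M N : MackeyFunctor C) :
    M.obj (⊤_ C) ⊗[BurnsideRing C] N.obj (⊤_ C) →ₗ[BurnsideRing C] (box M N).obj (⊤_ C) :=
  TensorProduct.lift (LinearMap.mk₂ _ (fun m n => boxPair M N (⊤_ C) m n)
    (fun m m' n => by simp)
    (fun r m n => by
      obtain ⟨r, rfl⟩ := topEquiv.surjective r
      rw [topEquiv_smul, topEquiv_smul, act_boxPair])
    (fun m n n' => by simp)
    (fun r m n => by
      obtain ⟨r, rfl⟩ := topEquiv.surjective r
      rw [topEquiv_smul, topEquiv_smul, act_boxPair, boxPair_act_right]))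

lemma boxPairTop_tmul (M N : MackeyFunctor C) (m : M.obj (⊤_ C)) (n : N.obj (⊤_ C)) :
    boxPairTop M N (m ⊗ₜ n) = boxPair M N (⊤_ C) m n := rfl

/-- The inverse of `freeBoxHom`. -/
def freeBoxInv (V W : Type (u + 1)) [AddCommGroup V] [Module (BurnsideRing C) V] [AddCommGroup W]
    [Module (BurnsideRing C) W] :
    (freeObj (V ⊗[BurnsideRing C] W) : MackeyFunctor C) ⟶ box (freeObj V) (freeObj W) :=
  freeDesc _ (boxPairTop (freeObj V) (freeObj W) ∘ₗ
    TensorProduct.map (freeUnit V).toLinearMap (freeUnit W).toLinearMap)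

lemma freeBoxInv_mk (a : (burnside C).obj X) (v : V) (w : W) :
    (freeBoxInv V W).app X (freeMk a (v ⊗ₜ w)) = (box _ _).act X a
      (boxPair _ _ X (freeMk (cls (𝟙 X)) v) (freeMk (cls (𝟙 X)) w)) := by
  rw [freeBoxInv, freeDesc_mk, LinearMap.comp_apply, TensorProduct.map_tmul, boxPairTop_tmul,
    LinearEquiv.coe_coe, LinearEquiv.coe_coe, freeUnit_apply, freeUnit_apply, res_boxPair,
    free_res_mk, free_res_mk, burnside_res_one]

/-- The functor `F` is compatible with tensor products. -/
def freeBoxIso (V W : Type (u + 1)) [AddCommGroup V] [Module (BurnsideRing C) V] [AddCommGroup W]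
    [Module (BurnsideRing C) W] :
    box (freeObj V) (freeObj W) ≅ (freeObj (V ⊗[BurnsideRing C] W) : MackeyFunctor C) where
  hom := freeBoxHom V W
  inv := freeBoxInv V W
  hom_inv_id := box_hom_ext fun X m n => free_ind₂
    ((boxPair (freeObj V) (freeObj W) X).compr₂ (Hom.app (freeBoxHom V W ≫ freeBoxInv V W) X))
    (boxPair (freeObj V) (freeObj W) X) (fun a v b w => by
      -- The image of `(a ⊗ v) ⊗ (b ⊗ w)` is `ab · ((1 ⊗ v) ⊗ (1 ⊗ w))`; here `b` is moved into the
      -- second factor and `a` into the first.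
      rw [AddMonoidHom.compr₂_apply, comp_app, freeBoxHom_pair, freeBoxInv_mk, act_act,
        act_boxPair, ← boxPair_act_right, act_boxPair, free_act, free_act, act_one_right,
        act_one_right]) m n
  inv_hom_id := free_hom_ext fun t => by
    rw [comp_app, id_app]
    induction t with
    | zero => rw [show freeMk (cls (𝟙 (⊤_ C))) (0 : V ⊗[BurnsideRing C] W) = 0 from
        TensorProduct.tmul_zero _ _, map_zero, map_zero]
    | tmul v w => rw [freeBoxInv_mk, hom_act, freeBoxHom_pair, act_one_right, free_act,
        act_one_right]
    | add s t hs ht => rw [freeMk_add_right, map_add, map_add, hs, ht]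

/-- The Burnside ring as the value of the Burnside Mackey functor, linearly. -/
def topLin : BurnsideRing C ≃ₗ[BurnsideRing C] (burnside C).obj (⊤_ C) where
  __ := topEquiv.symm
  map_smul' r a := by
    obtain ⟨r, rfl⟩ := topEquiv.surjective r
    rw [RingHom.id_apply, topEquiv_smul]
    rfl

lemma topLin_topEquiv (a : (burnside C).obj (⊤_ C)) : topLin (topEquiv a) = a := rfl

variable (C) in
/-- The functor `F` sends the Burnside ring to the Burnside Mackey functor. -/
def freeSelfIso : (freeObj (BurnsideRing C) : MackeyFunctor C) ≅ burnside C :=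
  isoOfInv (freeDesc (burnside C) topLin.toLinearMap)
    (fun X a => freeMk a 1)
    (fun X => free_ind ((AddMonoidHom.mk' (fun a => freeMk a (1 : BurnsideRing C))
      fun a b => freeMk_add_left a b 1).comp (Hom.app _ X)) (AddMonoidHom.id _) fun a r => by
        obtain ⟨r, rfl⟩ := topEquiv.surjective r
        simp only [AddMonoidHom.comp_apply, AddMonoidHom.mk'_apply, AddMonoidHom.id_apply]
        rw [freeDesc_mk, act_comm, LinearEquiv.coe_coe, topLin_topEquiv]
        refine (freeMk_smul (topEquiv r) a 1).trans ?_
        rw [smul_eq_mul, mul_one])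
    (fun X a => by
      rw [freeDesc_mk]
      refine Eq.trans ?_ (act_one_right a)
      exact congrArg ((burnside C).act X a) (resTop_one X))

/-- Linear equivalences induce isomorphisms of free Mackey functors. -/
def freeCongr (e : V ≃ₗ[BurnsideRing C] W) : (freeObj V : MackeyFunctor C) ≅ freeObj W :=
  (F C).mapIso e.toModuleIso

/-- Modules with isomorphic free Mackey functors are isomorphic. -/
def linearEquivOfFreeIso (e : (freeObj V : MackeyFunctor C) ≅ freeObj W) :
    V ≃ₗ[BurnsideRing C] W :=
  freeUnit V ≪≫ₗ LinearEquiv.ofBijective (appLin e.hom (⊤_ C)) (app_bijective e _) ≪≫ₗ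
    (freeUnit W).symm

variable (C) in
/-- The homomorphism from the Picard group of the Burnside ring to the monoid of isomorphism
classes of Mackey functors induced by `F`. -/
def picHom : CommRing.Pic (BurnsideRing C) →* IsoClass C where
  toFun P := isoClass (freeObj P.AsModule)
  map_one' := isoClass_eq_iff.2 ⟨freeCongr (CommRing.Pic.mk_eq_iff.1
      (CommRing.Pic.mk_self (R := BurnsideRing C))).some.symm ≪≫ freeSelfIso C⟩
  map_mul' P Q := by
    rw [isoClass_mul, isoClass_eq_iff]
    exact ⟨freeCongr (CommRing.Pic.mk_eq_iff.1
      (CommRing.Pic.mul_eq_tensor P Q).symm).some.symm ≪≫ (freeBoxIso _ _).symm⟩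

lemma picHom_mk [Module.Invertible (BurnsideRing C) V] :
    picHom C (CommRing.Pic.mk _ V) = isoClass (freeObj V) :=
  isoClass_eq_iff.2 ⟨freeCongr (CommRing.Pic.mk.linearEquiv _ V)⟩

/-- A module is recovered from its free Mackey functor by evaluation at the terminal object. -/
lemma picHom_injective : Function.Injective (picHom C) := fun _ _ h =>
  CommRing.Pic.ext_iff.2 ⟨linearEquivOfFreeIso (isoClass_eq_iff.1 h).some⟩

end FreeMonoidal
-- Marks: counting lifts from a connected object
section Marks

open PreGaloisCategory (IsConnected)

variable {C : Type (u + 1)} [Category.{u} C]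

/-- The lifts of `t : T ⟶ X` along `f : Y ⟶ X`. -/
abbrev Lifts {T X Y : C} (t : T ⟶ X) (f : Y ⟶ X) : Type u := {s : T ⟶ Y // s ≫ f = t}

/-- Lifts to a pullback. -/
def liftsPullback {T P X Y Z : C} {p : P ⟶ Y} {q : P ⟶ X} {f : Y ⟶ Z} {g : X ⟶ Z}
    (h : IsPullback p q f g) (t : T ⟶ X) : Lifts t q ≃ Lifts (t ≫ g) f where
  toFun s := ⟨s.1 ≫ p, by rw [Category.assoc, h.w, ← Category.assoc, s.2]⟩
  invFun s := ⟨h.lift s.1 t s.2, h.lift_snd _ _ _⟩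
  left_inv s := Subtype.ext (h.hom_ext (by simp) (by simp [s.2]))
  right_inv s := Subtype.ext (h.lift_fst _ _ _)

/-- Lifts along a composition. -/
def liftsComp {T X Y Z : C} (t : T ⟶ Z) (f : Y ⟶ X) (g : X ⟶ Z) :
    Lifts t (f ≫ g) ≃ (s : Lifts t g) × Lifts s.1 f where
  toFun u := ⟨⟨u.1 ≫ f, by rw [Category.assoc, u.2]⟩, ⟨u.1, rfl⟩⟩
  invFun v := ⟨v.2.1, by rw [← Category.assoc, v.2.2, v.1.2]⟩
  left_inv _ := rfl
  right_inv := by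
    rintro ⟨⟨s, hs⟩, ⟨u, hu⟩⟩
    change u ≫ f = s at hu
    subst hu hs
    rfl

variable [FinitaryExtensive C]

/-- Pulling the coproduct back along `s` decomposes `T` into two subobjects. By connectedness, one
that is not initial is all of `T`, and both being initial would make `T` initial. -/
lemma connected_factors {T A B Y : C} [HasPullbacks C] [IsConnected T] {i : A ⟶ Y} {j : B ⟶ Y}
    (h : IsCoprod i j) (s : T ⟶ Y) : (∃ a, a ≫ i = s) ∨ ∃ b, b ≫ j = s := by
  have key : ∀ {A B : C} {i : A ⟶ Y} {j : B ⟶ Y}, IsCoprod i j →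
      (IsInitial (pullback s i) → False) → ∃ a, a ≫ i = s := by
    intro A B i j h hn
    have : Mono i := FinitaryExtensive.mono_inl_of_isColimit h.some
    have := IsConnected.noTrivialComponent _ (pullback.fst s i) hn
    exact ⟨inv (pullback.fst s i) ≫ pullback.snd s i, by
      rw [Category.assoc, ← pullback.condition, IsIso.inv_hom_id_assoc]⟩
  by_contra hc
  rw [not_or] at hc
  have hi : Nonempty (IsInitial (pullback s i)) := by
    by_contra hn
    exact hc.1 (key h fun k => hn ⟨k⟩)
  have hj : Nonempty (IsInitial (pullback s j)) := by
    by_contra hn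
    exact hc.2 (key (isCoprod_symm h) fun k => hn ⟨k⟩)
  obtain ⟨⟨hi⟩, ⟨hj⟩⟩ := And.intro hi hj
  have hT := (isCoprod_of_isPullback h (IsPullback.of_hasPullback s i)
    (IsPullback.of_hasPullback s j)).some
  exact IsConnected.notInitial (X := T) (IsInitial.ofUniqueHom
    (fun Z => hT.desc (BinaryCofan.mk (hi.to Z) (hj.to Z)))
    (fun Z m => BinaryCofan.IsColimit.hom_ext hT (hi.hom_ext _ _) (hj.hom_ext _ _)))

/-- The summands have initial intersection, and initial objects are strict, so `T` would be initial.
-/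
lemma connected_disjoint {T A B Y : C} [IsConnected T] {i : A ⟶ Y} {j : B ⟶ Y}
    (h : IsCoprod i j) (a : T ⟶ A) (b : T ⟶ B) (hab : a ≫ i = b ≫ j) : False := by
  have hp : IsPullback (initial.to A) (initial.to B) i j :=
    FinitaryExtensive.isPullback_initial_to_binaryCofan h.some
  have hI := initialIsInitial (C := C)
  have := hI.isIso_to (hp.lift a b hab)
  exact IsConnected.notInitial (X := T) (hI.ofIso (asIso (hp.lift a b hab)).symm)

/-- A lift from a connected object to a coproduct is a lift to one of the summands. -/
def liftsCoprod {T A B X Y : C} [HasPullbacks C] [IsConnected T] {i : A ⟶ Y} {j : B ⟶ Y}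
    (h : IsCoprod i j) (t : T ⟶ X) (f : Y ⟶ X) :
    Lifts t (i ≫ f) ⊕ Lifts t (j ≫ f) ≃ Lifts t f :=
  Equiv.ofBijective
    (Sum.elim (fun a => ⟨a.1 ≫ i, by rw [Category.assoc, a.2]⟩)
      (fun b => ⟨b.1 ≫ j, by rw [Category.assoc, b.2]⟩)) (by
    have : Mono i := FinitaryExtensive.mono_inl_of_isColimit h.some
    have : Mono j := FinitaryExtensive.mono_inr_of_isColimit h.some
    constructor
    · rintro (⟨a, ha⟩ | ⟨a, ha⟩) (⟨b, hb⟩ | ⟨b, hb⟩) hab <;>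
        simp only [Sum.elim_inl, Sum.elim_inr, Subtype.mk.injEq] at hab
      · rw [cancel_mono] at hab
        subst hab
        rfl
      · exact (connected_disjoint h a b hab).elim
      · exact (connected_disjoint h b a hab.symm).elim
      · rw [cancel_mono] at hab
        subst hab
        rfl
    · rintro ⟨s, rfl⟩
      rcases connected_factors h s with ⟨a, rfl⟩ | ⟨b, rfl⟩
      · exact ⟨Sum.inl ⟨a, by rw [Category.assoc]⟩, rfl⟩
      · exact ⟨Sum.inr ⟨b, by rw [Category.assoc]⟩, rfl⟩)

variable [HasPullbacks C] {T : C} [IsConnected T] [hT : ∀ Y : C, Finite (T ⟶ Y)] {X Y Z : C}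

/-- The mark at `t : T ⟶ X`, for a connected object `T`: it counts the lifts of `t`. For finite
`G`-sets and `T = G/H` this is the number of `H`-fixed points in the fibre over a fixed point. -/
def mark (t : T ⟶ X) : (burnside C).obj X →+ ℤ :=
  burnsideLift (fun f => (Nat.card (Lifts t f) : ℤ))
    (fun {Y Z} e f => by
      refine congrArg Nat.cast (Nat.card_congr ⟨fun s => ⟨s.1 ≫ e.hom, by simp [s.2]⟩,
        fun s => ⟨s.1 ≫ e.inv, by simp [s.2]⟩, fun s => by simp, fun s => by simp⟩))
    (fun h f => by
      rw [← Nat.card_congr (liftsCoprod h t f), Nat.card_sum, Nat.cast_add])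

lemma mark_cls (t : T ⟶ X) (f : Y ⟶ X) : mark t (cls f) = Nat.card (Lifts t f) :=
  burnsideLift_cls₀ _ _ _ f

lemma mark_one (t : T ⟶ X) : mark t (cls (𝟙 X)) = 1 := by
  rw [mark_cls]
  have : Unique (Lifts t (𝟙 X)) :=
    ⟨⟨⟨t, Category.comp_id t⟩⟩, fun s => Subtype.ext ((Category.comp_id _).symm.trans s.2)⟩
  simp

lemma mark_res (t : T ⟶ X) (g : X ⟶ Y) (a : (burnside C).obj Y) :
    mark t ((burnside C).res g a) = mark (t ≫ g) a := by
  refine burnside_ind ((mark t).comp ((burnside C).res g)) (mark (t ≫ g)) (fun f => ?_) a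
  have h := IsPullback.of_hasPullback f g
  rw [AddMonoidHom.comp_apply, burnside_res_cls h, mark_cls, mark_cls,
    Nat.card_congr (liftsPullback h t)]

/-- A lift along a composite is a lift `s` along the second morphism followed by a lift of `s` along
the first. -/
lemma mark_tr (t : T ⟶ Y) (g : X ⟶ Y) [Fintype (Lifts t g)] (a : (burnside C).obj X) :
    mark t ((burnside C).tr g a) = ∑ s : Lifts t g, mark s.1 a := by
  refine (burnside_ind ((mark t).comp ((burnside C).tr g)) (∑ s : Lifts t g, mark s.1)
    (fun f => ?_) a).trans (AddMonoidHom.finsetSum_apply _ _ _)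
  rw [AddMonoidHom.comp_apply, burnside_tr_cls, AddMonoidHom.finsetSum_apply, mark_cls,
    Nat.card_congr (liftsComp t f g), Nat.card_sigma, Nat.cast_sum]
  exact Finset.sum_congr rfl fun s _ => (mark_cls s.1 f).symm

/-- For `a = [f]` the product is `tr f (res f b)`. Its mark is a sum over the lifts `s` of `t`, and
each term is the mark of `b` at `s ≫ f = t`. -/
lemma mark_act (t : T ⟶ X) (a b : (burnside C).obj X) :
    mark t ((burnside C).act X a b) = mark t a * mark t b := by
  refine burnside_ind ((mark t).comp (((burnside C).act X).flip b))
    ((AddMonoidHom.mulRight (mark t b)).comp (mark t)) (fun f => ?_) a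
  have := Fintype.ofFinite (Lifts t f)
  rw [AddMonoidHom.comp_apply, AddMonoidHom.flip_apply, act_cls, mark_tr,
    AddMonoidHom.comp_apply, AddMonoidHom.coe_mulRight, mark_cls, Nat.card_eq_fintype_card,
    Finset.sum_congr rfl fun s _ => (mark_res s.1 f b).trans (by rw [s.2]), Finset.sum_const,
    Finset.card_univ, nsmul_eq_mul]

lemma mark_iso_comp (a : T ≅ T) (t : T ⟶ X) : mark (a.hom ≫ t) = mark t := by
  refine AddMonoidHom.ext (burnside_ind _ _ fun f => ?_)
  rw [mark_cls, mark_cls]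
  exact congrArg Nat.cast (Nat.card_congr ⟨fun s => ⟨a.inv ≫ s.1, by simp [s.2]⟩,
    fun s => ⟨a.hom ≫ s.1, by simp [s.2]⟩, fun s => by simp, fun s => by simp⟩)

end Marks
-- Prime ideals of the Burnside ring
section Primes

open PreGaloisCategory

variable {C : Type (u + 1)} [Category.{u} C]

/-- The section is a non-initial subobject of the connected object `S`, hence all of `S`. -/
lemma isIso_of_section {S T : C} [PreGaloisCategory.IsConnected S]
    [PreGaloisCategory.IsConnected T] (f : S ⟶ T) (s : T ⟶ S)
    (h : s ≫ f = 𝟙 T) : IsIso f := by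
  have : Mono s := mono_of_mono_fac h
  have := PreGaloisCategory.IsConnected.noTrivialComponent _ s
    PreGaloisCategory.IsConnected.notInitial
  rw [← IsIso.eq_inv_comp, Category.comp_id] at h
  rw [h]
  infer_instance

variable [PreGaloisCategory C]

lemma finite_hom_of_isConnected (Φ : C ⥤ FintypeCat.{u}) [FiberFunctor Φ]
    (T Y : C) [PreGaloisCategory.IsConnected T] : Finite (T ⟶ Y) :=
  Finite.of_injective _
    (evaluation_injective_of_isConnected Φ T Y (Classical.arbitrary (Φ.obj T)))

/-- Every object is built from connected objects by coproducts. -/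
lemma connected_induction (Φ : C ⥤ FintypeCat.{u}) [FiberFunctor Φ]
    {P : C → Prop} (h0 : ∀ X, IsInitial X → P X)
    (h1 : ∀ X, PreGaloisCategory.IsConnected X → P X)
    (h2 : ∀ {A B Y : C} {i : A ⟶ Y} {j : B ⟶ Y}, IsCoprod i j → P A → P B → P Y) (X : C) : P X := by
  induction hn : Nat.card (Φ.obj X) using Nat.strong_induction_on generalizing X with
  | _ n ih =>
    by_cases hc : PreGaloisCategory.IsConnected X
    · exact h1 X hc
    by_cases hi : Nonempty (IsInitial X)
    · exact h0 X hi.some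
    -- A proper non-initial subobject splits off as a direct summand. Fibre cardinalities add up, so
    -- both summands have strictly smaller fibres.
    obtain ⟨Y, v, hY, hv, hviso⟩ :=
      has_non_trivial_subobject_of_not_isConnected_of_not_initial X hc fun h => hi ⟨h⟩
    obtain ⟨Z, w, ⟨c⟩⟩ := PreGaloisCategory.monoInducesIsoOnDirectSummand v
    have hYX := lt_card_fiber_of_mono_of_notIso Φ v hviso
    have hsum : Nat.card (Φ.obj X) = Nat.card (Φ.obj Y) + Nat.card (Φ.obj Z) :=
      (card_fiber_eq_of_iso Φ (colimit.isoColimitCocone ⟨_, c⟩).symm).trans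
        (card_fiber_coprod_eq_sum Φ Y Z)
    have hY0 := non_zero_card_fiber_of_not_initial Φ Y hY
    exact h2 ⟨c⟩ (ih _ (by omega) Y rfl) (ih _ (by omega) Z rfl)

/-- A morphism of connected objects that is not an isomorphism increases the fibre. -/
lemma card_fiber_lt_of_not_isIso (Φ : C ⥤ FintypeCat.{u}) [FiberFunctor Φ]
    {S T : C} [PreGaloisCategory.IsConnected S] [PreGaloisCategory.IsConnected T] (f : S ⟶ T)
    (hf : ¬ IsIso f) : Nat.card (Φ.obj T) < Nat.card (Φ.obj S) := by
  have hs := surjective_of_nonempty_fiber_of_isConnected Φ f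
  refine lt_of_le_of_ne (Nat.card_le_card_of_surjective _ hs) fun h => hf ?_
  have hb : Function.Bijective (Φ.map f) :=
    hs.bijective_of_nat_card_le h.ge
  have : IsIso (Φ.map f) := (ConcreteCategory.isIso_iff_bijective (Φ.map f)).2 hb
  exact isIso_of_reflects_iso f Φ

lemma isIso_of_endo (Φ : C ⥤ FintypeCat.{u}) [FiberFunctor Φ]
    {T : C} [PreGaloisCategory.IsConnected T] (f : T ⟶ T) : IsIso f := by
  by_contra h
  exact lt_irrefl _ (card_fiber_lt_of_not_isIso Φ f h)

variable [FinitaryExtensive C]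

/-- The class of an object in the Burnside ring. -/
def classOf (Y : C) : BurnsideRing C := topEquiv (cls (terminal.from Y))

lemma cls_of_isInitial {X Y : C} (h : IsInitial Y) (f : Y ⟶ X) : cls f = 0 := by
  have hc : IsCoprod (𝟙 Y) (𝟙 Y) := ⟨BinaryCofan.IsColimit.mk _ (fun _ _ => h.to _)
    (fun _ _ => h.hom_ext _ _) (fun _ _ => h.hom_ext _ _) (fun _ _ _ _ _ => h.hom_ext _ _)⟩
  have := cls₀_coprod hc f
  rw [Category.id_comp] at this
  exact left_eq_add.1 this

lemma cls_coprod {X A B Y : C} {i : A ⟶ Y} {j : B ⟶ Y} (h : IsCoprod i j) (f : Y ⟶ X) :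
    cls f = cls (i ≫ f) + cls (j ≫ f) := cls₀_coprod h f

lemma classOf_coprod {A B Y : C} {i : A ⟶ Y} {j : B ⟶ Y} (h : IsCoprod i j) :
    classOf Y = classOf A + classOf B := by
  rw [classOf, cls_coprod h, map_add, terminal.comp_from, terminal.comp_from]
  rfl

lemma classOf_of_isInitial {Y : C} (h : IsInitial Y) : classOf Y = 0 := by
  rw [classOf, cls_of_isInitial h, map_zero]

lemma classOf_iso {Y Z : C} (e : Y ≅ Z) : classOf Y = classOf Z := by
  rw [classOf, ← terminal.comp_from e.hom]
  exact cls₀_iso e _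

lemma classOf_terminal : classOf (⊤_ C) = 1 := by
  rw [classOf, terminal.hom_ext (terminal.from (⊤_ C)) (𝟙 _), topEquiv_one]

/-- A connected object detects a prime ideal of the Burnside ring if its class is not in the ideal,
but the classes of all connected objects strictly above it are. -/
structure Detects (T : C) (M : Ideal (BurnsideRing C)) : Prop where
  notMem : classOf T ∉ M
  mem : ∀ (S : C) [PreGaloisCategory.IsConnected S] (f : S ⟶ T), ¬ IsIso f → classOf S ∈ M

/-- Some connected object has class outside `M`, since otherwise every class, including `1 = [⊤_
C]`, would lie in `M`. Among these, one with the largest fibre works: a connected object mapping to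
it by a non-isomorphism has a larger fibre. The bound `n` makes the maximum exist. -/
lemma exists_detects (Φ : C ⥤ FintypeCat.{u}) [FiberFunctor Φ]
    (M : Ideal (BurnsideRing C)) (hM : M ≠ ⊤) (n : ℕ)
    (hn : ∀ (T : C) [PreGaloisCategory.IsConnected T], Nat.card (Φ.obj T) ≤ n) :
    ∃ (T : C) (_ : PreGaloisCategory.IsConnected T), Detects T M := by
  -- Minimizing `k = n - |Φ(T)|` maximizes the fibre; by the bound `n` the subtraction does not
  -- truncate.
  have hex : ∃ k, ∃ (T : C) (_ : PreGaloisCategory.IsConnected T),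
      classOf T ∉ M ∧ n - Nat.card (Φ.obj T) = k := by
    by_contra hc
    push Not at hc
    have hall : ∀ Y : C, classOf Y ∈ M := connected_induction Φ
      (fun X hX => by rw [classOf_of_isInitial hX]; exact M.zero_mem)
      (fun X hX => by
        by_contra h
        exact hc _ X hX h rfl)
      (fun h hA hB => by rw [classOf_coprod h]; exact M.add_mem hA hB)
    exact hM ((Ideal.eq_top_iff_one M).2 (classOf_terminal (C := C) ▸ hall (⊤_ C)))
  classical
  obtain ⟨T, hT, hTM, hk⟩ := Nat.find_spec hex
  refine ⟨T, hT, hTM, fun S hS f hf => ?_⟩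
  by_contra hSM
  have h1 := card_fiber_lt_of_not_isIso Φ f hf
  have h2 := Nat.find_min' hex ⟨S, hS, hSM, rfl⟩
  have h3 := hn S
  have h4 := hn T
  omega

variable {T : C} [PreGaloisCategory.IsConnected T] [hT : ∀ Y : C, Finite (T ⟶ Y)]
  {M : Ideal (BurnsideRing C)}

/-- Modulo a prime ideal detected by `T`, only the sections of an object over `T` matter. -/
lemma Detects.sub_mem (Φ : C ⥤ FintypeCat.{u}) [FiberFunctor Φ]
    (h : Detects T M) {Y : C} (f : Y ⟶ T) :
    classOf Y - (mark (𝟙 T) (cls f) : BurnsideRing C) * classOf T ∈ M := by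
  revert f
  refine connected_induction Φ (P := fun Y => ∀ f : Y ⟶ T,
    classOf Y - (mark (𝟙 T) (cls f) : BurnsideRing C) * classOf T ∈ M) ?_ ?_ ?_ Y
  · intro X hX f
    rw [classOf_of_isInitial hX, cls_of_isInitial hX]
    simp
  -- For connected `S`, either `f` is an isomorphism and has exactly one section, or it has no
  -- section and `[S]` lies in `M`.
  · intro S hS f
    by_cases hf : IsIso f
    · have h1 : cls f = cls (𝟙 T) := by
        rw [← Category.comp_id f]
        exact cls₀_iso (asIso f) (𝟙 T)
      rw [h1, mark_one, classOf_iso (asIso f)]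
      simp
    · have : IsEmpty (Lifts (𝟙 T) f) := ⟨fun s => hf (isIso_of_section f s.1 s.2)⟩
      rw [mark_cls]
      simpa using h.mem S f hf
  · intro A B Y i j hc hA hB f
    rw [classOf_coprod hc, cls_coprod hc, map_add]
    convert M.add_mem (hA (i ≫ f)) (hB (j ≫ f)) using 1
    push_cast
    ring

/-- Since `[T]` is not in the prime `M`, the congruence may be checked after multiplication by
`[T]`. There `[T][Y] = [T × Y]`, and the sections of `T × Y ⟶ T` are the morphisms `T ⟶ Y`, which
the mark counts. -/
lemma Detects.sub_mark_mem (Φ : C ⥤ FintypeCat.{u}) [FiberFunctor Φ]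
    [hp : M.IsPrime] (h : Detects T M) (x : (burnside C).obj (⊤_ C)) :
    topEquiv x - (mark (terminal.from T) x : BurnsideRing C) ∈ M := by
  refine (hp.mem_or_mem (x := classOf T) ?_).resolve_left h.notMem
  rw [← Ideal.Quotient.eq_zero_iff_mem]
  let q := Ideal.Quotient.mk M
  refine burnside_ind (q.toAddMonoidHom.comp ((AddMonoidHom.mulLeft (classOf T)).comp
    (topEquiv.toAddMonoidHom -
      (Int.castAddHom (BurnsideRing C)).comp (mark (terminal.from T))))) 0 (fun {Y} f => ?_) x
  refine Ideal.Quotient.eq_zero_iff_mem.2 ?_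
  have hp := IsPullback.of_hasPullback (terminal.from T) f
  have h1 : classOf T * topEquiv (cls f) = classOf (pullback (terminal.from T) f) := by
    rw [classOf, ← topEquiv_act, act_cls_cls hp, classOf]
    congr 2
    exact terminal.hom_ext _ _
  have h2 := h.sub_mem Φ (pullback.fst (terminal.from T) f)
  rw [← h1, mark_cls, Nat.card_congr (liftsPullback hp.flip _), Category.id_comp,
    ← mark_cls] at h2
  change classOf T * (topEquiv (cls f) - ((mark (terminal.from T) (cls f) : ℤ) :
    BurnsideRing C)) ∈ M
  rwa [mul_sub, mul_comm (classOf T) (Int.cast _)]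

end Primes
end MackeyFunctor

/-! ### A fixed point congruence -/

/-- If `c` is a permutation of `ℓ`-power order and `g` is a `c`-invariant function that vanishes on
the fixed points of `c`, then the sum of the values of `g` vanishes modulo `ℓ`. -/
lemma sum_eq_zero_of_fixedPoints {S : Type*} [Fintype S] (c : S → S) {ℓ k : ℕ}
    [Fact ℓ.Prime] (hc : c^[ℓ ^ k] = id) (g : S → ZMod ℓ) (hg : ∀ s, g (c s) = g s)
    (h0 : ∀ s, c s = s → g s = 0) : ∑ s, g s = 0 := by
  classical
  -- Group the terms by the value `v` of `g`. For `v ≠ 0`, the map `c` acts without fixed points on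
  -- the level set, whose size is therefore divisible by `ℓ`.
  rw [← Finset.sum_fiberwise Finset.univ g g]
  refine Finset.sum_eq_zero fun v _ => ?_
  rw [Finset.sum_congr rfl fun s hs => (Finset.mem_filter.1 hs).2, Finset.sum_const, nsmul_eq_mul]
  by_cases hv : v = 0
  · rw [hv, mul_zero]
  let d : Function.End {s // g s = v} := fun s => ⟨c s.1, (hg s.1).trans s.2⟩
  have hd : ∀ n s, ((d ^ n) s).1 = c^[n] s.1 := by
    intro n
    induction n with
    | zero => exact fun s => rfl
    | succ n ih =>
      intro s
      rw [Function.iterate_succ_apply]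
      exact (congrArg Subtype.val (congrFun (pow_succ d n) s)).trans (ih _)
  have hd1 : d ^ ℓ ^ k = 1 := funext fun s => Subtype.ext (by rw [hd, hc]; rfl)
  have hcard := Equiv.Perm.card_fixedPoints_modEq hd1
  have hempty : IsEmpty (Function.fixedPoints d) :=
    ⟨fun s => hv (s.1.2.symm.trans (h0 _ (congrArg Subtype.val s.2)))⟩
  rw [Fintype.card_eq_zero (α := Function.fixedPoints d), ← ZMod.natCast_eq_natCast_iff,
    Fintype.card_subtype] at hcard
  rw [hcard, Nat.cast_zero, zero_mul]

namespace MackeyFunctor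

lemma aut_mul_hom {C : Type*} [Category C] {T : C} (a b : Aut T) :
    (a * b).hom = b.hom ≫ a.hom := rfl

/-! ### The pairing of an invertible Mackey functor with its inverse -/

section Pairing

variable {C : Type (u + 1)} [Category.{u} C] [HasPullbacks C] [FinitaryExtensive C]
  {N N' : MackeyFunctor C} (e : box N N' ≅ burnside C) {X Y : C}

/-- The pairing with values in the Burnside Mackey functor defined by an isomorphism from a box
product to the unit. -/
def pairing (X : C) : N.obj X →+ N'.obj X →+ (burnside C).obj X :=
  (boxPair N N' X).compr₂ (e.hom.app X)

lemma pairing_apply (m : N.obj X) (n : N'.obj X) :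
    pairing e X m n = e.hom.app X (boxPair N N' X m n) := rfl

lemma res_pairing (f : Y ⟶ X) (m : N.obj X) (n : N'.obj X) :
    (burnside C).res f (pairing e X m n) = pairing e Y (N.res f m) (N'.res f n) := by
  rw [pairing_apply, ← e.hom.app_res, res_boxPair, pairing_apply]

lemma pairing_tr_left (f : Y ⟶ X) (m : N.obj Y) (n : N'.obj X) :
    pairing e X (N.tr f m) n = (burnside C).tr f (pairing e Y m (N'.res f n)) := by
  rw [pairing_apply, boxPair_tr_left, e.hom.app_tr, pairing_apply]

lemma pairing_act_left (a : (burnside C).obj X) (m : N.obj X) (n : N'.obj X) :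
    pairing e X (N.act X a m) n = (burnside C).act X a (pairing e X m n) := by
  rw [pairing_apply, ← act_boxPair, hom_act, pairing_apply]

lemma hom_boxMk (f : Y ⟶ X) (m : N.obj Y) (n : N'.obj Y) :
    e.hom.app X (boxMk f m n) = (burnside C).tr f (pairing e Y m n) := by
  rw [← tr_boxPair, e.hom.app_tr, pairing_apply]

lemma pairing_swap (m : N.obj X) (n : N'.obj X) :
    pairing (boxComm N' N ≪≫ e) X n m = pairing e X m n :=
  congrArg (e.hom.app X) (boxSwap_pair n m)

lemma boxUnit_pair (M : MackeyFunctor C) (a : (burnside C).obj X) (x : M.obj X) :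
    (boxUnit M).hom.app X (boxPair _ _ X a x) = M.act X a x :=
  (boxDesc_mk M.act (res_act M) _ _ (𝟙 X) a x).trans (M.tr_id ..)

lemma boxIso_hom {M M' N N' : MackeyFunctor C} (e : M ≅ M') (e' : N ≅ N') :
    (boxIso e e').hom = boxMap e.hom e'.hom := rfl

lemma boxComm_hom (M N : MackeyFunctor C) : (boxComm M N).hom = boxSwap M N := rfl

lemma boxAssoc_inv (M N P : MackeyFunctor C) : (boxAssoc M N P).inv = assocInv M N P := rfl

/-- The two ways to contract `n ⊗ y ⊗ x` differ by an automorphism. -/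
lemma exists_twist : ∃ θ : N ≅ N, ∀ (X : C) (n x : N.obj X) (y : N'.obj X),
    θ.hom.app X (N.act X (pairing e X x y) n) = N.act X (pairing e X n y) x := by
  -- `α` contracts the first two of the three factors, `β` the last two; the twist is `β⁻¹` followed
  -- by `α`.
  let α : box N (box N' N) ≅ N :=
    (boxAssoc N N' N).symm ≪≫ boxIso e (Iso.refl N) ≪≫ boxUnit N
  let β : box N (box N' N) ≅ N :=
    boxIso (Iso.refl N) (boxComm N' N ≪≫ e) ≪≫ boxComm N (burnside C) ≪≫ boxUnit N
  refine ⟨β.symm ≪≫ α, fun X n x y => ?_⟩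
  have hα : α.hom.app X (boxPair _ _ X n (boxPair _ _ X y x)) = N.act X (pairing e X n y) x := by
    simp only [α, Iso.trans_hom, comp_app, Iso.symm_hom, boxAssoc_inv, boxIso_hom, Iso.refl_hom]
    rw [assocInv_pair, boxMap_pair, boxUnit_pair, id_app, pairing_apply]
  have hβ : β.hom.app X (boxPair _ _ X n (boxPair _ _ X y x)) = N.act X (pairing e X x y) n := by
    simp only [β, Iso.trans_hom, comp_app, boxComm_hom, boxIso_hom, Iso.refl_hom]
    rw [boxMap_pair, boxSwap_pair, boxUnit_pair, id_app, comp_app, boxSwap_pair, pairing_apply]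
  rw [← hα, ← hβ]
  exact congrArg (α.hom.app X) (iso_hom_inv β X _)

variable {T : C} [PreGaloisCategory.IsConnected T] [hT : ∀ Y : C, Finite (T ⟶ Y)]

variable (T) in
/-- The integral bilinear form on the values at a connected object. -/
def markForm (m : N.obj T) (n : N'.obj T) : ℤ := mark (𝟙 T) (pairing e T m n)

lemma mark_pairing (t : T ⟶ X) (m : N.obj X) (n : N'.obj X) :
    mark t (pairing e X m n) = markForm e T (N.res t m) (N'.res t n) := by
  rw [markForm, ← res_pairing, mark_res, Category.id_comp]

lemma markForm_swap (m : N.obj T) (n : N'.obj T) :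
    markForm (boxComm N' N ≪≫ e) T n m = markForm e T m n :=
  congrArg (mark (𝟙 T)) (pairing_swap e m n)

lemma markForm_res_iso (a : T ≅ T) (m : N.obj T) (n : N'.obj T) :
    markForm e T (N.res a.hom m) (N'.res a.hom n) = markForm e T m n := by
  rw [← mark_pairing, ← Category.comp_id a.hom, mark_iso_comp, markForm]

/-- The form `markForm` has rank one. -/
lemma markForm_mul (m m' : N.obj T) (n n' : N'.obj T) :
    markForm e T m n' * markForm e T m' n = markForm e T m' n' * markForm e T m n := by
  obtain ⟨θ, hθ⟩ := exists_twist e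
  have h : ∀ (m m' : N.obj T) (n n' : N'.obj T), markForm e T m n' * markForm e T m' n =
      markForm e T m' n' * markForm e T (θ.hom.app T m) n := by
    -- Apply the mark to `⟨⟨m, n'⟩ m', n⟩`: marks are multiplicative, and the twist exchanges `m`
    -- and `m'`.
    intro m m' n n'
    rw [markForm, markForm, ← mark_act, ← pairing_act_left, ← hθ, hom_act, pairing_act_left,
      mark_act, markForm, markForm]
  by_cases hz : ∀ (m : N.obj T) (n : N'.obj T), markForm e T m n = 0
  · rw [hz, hz m' n', zero_mul, zero_mul]
  push Not at hz
  obtain ⟨m₀, n₀, hz⟩ := hz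
  -- The twist is invisible to the form: it fixes the nonzero value at `(m₀, n₀)`, and comparing `h`
  -- for `(m, m₀)` and `(m₀, m)` carries this over to every `(m, n)`.
  have h1 := mul_left_cancel₀ hz (h m₀ m₀ n₀ n₀)
  have h2 : markForm e T (θ.hom.app T m) n = markForm e T m n := by
    have h3 := h m m₀ n n₀
    have h4 := h m₀ m n₀ n
    rw [← h1] at h4
    apply mul_left_cancel₀ hz
    linarith
  rw [h, h2]

end Pairing

/-! ### Automorphisms of a connected object act trivially on the form -/

section Automorphisms

variable {C : Type (u + 1)} [Category.{u} C] [HasPullbacks C] [FinitaryExtensive C]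
  [HasTerminal C] {N N' : MackeyFunctor C} (e : box N N' ≅ burnside C)
  {T : C} [PreGaloisCategory.IsConnected T] [hT : ∀ Y : C, Finite (T ⟶ Y)]

/-- The mark of the image of a generator `m ⊗ n` over `X` is a sum over the morphisms `s : T ⟶ X`,
on which `a` acts by precomposition. Modulo `ℓ` only the fixed `s` matter, and for these the
restrictions of `m` and `n` are `a`-invariant. If the form vanished on invariant pairs, every mark
would be `0` modulo `ℓ`, including the mark of `1`. -/
lemma exists_markForm_ne_zero (a : Aut T) {ℓ k : ℕ} [Fact ℓ.Prime] (ha : a ^ ℓ ^ k = 1) :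
    ∃ (m : N.obj T) (n : N'.obj T), N.res a.hom m = m ∧ N'.res a.hom n = n ∧
      markForm e T m n ≠ 0 := by
  by_contra hc
  push Not at hc
  have key : ∀ z : (box N N').obj (⊤_ C),
      ((mark (terminal.from T) (e.hom.app _ z) : ℤ) : ZMod ℓ) = 0 := by
    intro z
    refine box_ind ((Int.castAddHom (ZMod ℓ)).comp ((mark (terminal.from T)).comp
      (e.hom.app (⊤_ C)))) 0 (fun {X} f m n => ?_) z
    have := Fintype.ofFinite (Lifts (terminal.from T) f)
    simp only [AddMonoidHom.comp_apply, Int.coe_castAddHom, AddMonoidHom.zero_apply]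
    rw [hom_boxMk, mark_tr, Int.cast_sum]
    let c : Lifts (terminal.from T) f → Lifts (terminal.from T) f :=
      fun s => ⟨a.hom ≫ s.1, terminal.hom_ext _ _⟩
    have hck : ∀ n s, (c^[n] s).1 = (a ^ n).hom ≫ s.1 := by
      intro n
      induction n with
      | zero => exact fun s => (Category.id_comp s.1).symm
      | succ n ih =>
        intro s
        rw [Function.iterate_succ_apply, ih, pow_succ', aut_mul_hom,
          Category.assoc]
    refine sum_eq_zero_of_fixedPoints (k := k) c ?_ _ (fun s => ?_) fun s hs => ?_
    · exact funext fun s => Subtype.ext (by rw [hck, ha]; exact Category.id_comp s.1)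
    · exact congrArg (fun t => ((t (pairing e X m n) : ℤ) : ZMod ℓ)) (mark_iso_comp a s.1)
    · have hs' : a.hom ≫ s.1 = s.1 := congrArg Subtype.val hs
      rw [mark_pairing, hc _ _ (by rw [← N.res_comp, hs']) (by rw [← N'.res_comp, hs']),
        Int.cast_zero]
  obtain ⟨z, hz⟩ := (app_bijective e (⊤_ C)).2 (cls (𝟙 _))
  have := key z
  rw [hz, mark_one, Int.cast_one] at this
  exact one_ne_zero this

/-- The automorphisms that act trivially on the left argument of `markForm`. -/
def trivialAut (T : C) [PreGaloisCategory.IsConnected T] [∀ Y : C, Finite (T ⟶ Y)] :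
    Subgroup (Aut T) where
  carrier := {a | ∀ (m : N.obj T) (n : N'.obj T), markForm e T (N.res a.hom m) n = markForm e T m n}
  one_mem' m n := congrArg (markForm e T · n) (N.res_id T m)
  mul_mem' {a b} ha hb m n := by
    rw [aut_mul_hom, N.res_comp, hb, ha]
  inv_mem' {a} ha m n := by
    rw [← ha, ← N.res_comp]
    exact (congrArg (fun f => markForm e T (N.res f m) n) a.hom_inv_id).trans
      (congrArg (markForm e T · n) (N.res_id T m))

/-- Prime power orders suffice, because a general `a` is a product of powers of elements of coprime
orders. For prime power order, the rank one relation against an invariant pair with nonzero form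
value gives the claim. -/
lemma mem_trivialAut (a : Aut T) : a ∈ trivialAut e T := by
  have : Finite (Aut T) := Finite.of_injective (fun a : Aut T => a.hom) fun a b => Aut.ext
  suffices h : ∀ n : ℕ, n ≠ 0 → ∀ a : Aut T, a ^ n = 1 → a ∈ trivialAut e T from
    h _ (isOfFinOrder_of_finite a).orderOf_pos.ne' a (pow_orderOf_eq_one a)
  intro n
  induction n using Nat.recOnPosPrimePosCoprime with
  | prime_pow ℓ k hℓ _ =>
    intro _ a ha m n
    have : Fact ℓ.Prime := ⟨hℓ⟩
    obtain ⟨m₀, n₀, hm, hn, h⟩ := exists_markForm_ne_zero e a ha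
    have h1 := markForm_mul e (N.res a.hom m) m₀ n n₀
    -- The form is unchanged when `a` acts on both arguments, and `n₀` is already invariant.
    have h2 : markForm e T (N.res a.hom m) n₀ = markForm e T m n₀ := by
      rw [← markForm_res_iso e a m n₀, hn]
    rw [h2, markForm_mul] at h1
    exact (mul_left_cancel₀ h h1).symm
  | zero => exact fun h => absurd rfl h
  | one =>
    intro _ a ha
    rw [pow_one] at ha
    exact ha ▸ one_mem _
  | coprime p q hp hq hpq ihp ihq =>
    intro _ a ha
    have h1 : a ^ p ∈ trivialAut e T := ihq (by omega) _ (by rw [← pow_mul, ha])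
    have h2 : a ^ q ∈ trivialAut e T := ihp (by omega) _ (by rw [← pow_mul, mul_comm, ha])
    have h3 := Int.gcd_eq_gcd_ab p q
    rw [Int.gcd_natCast_natCast, hpq] at h3
    -- Bézout for the coprime orders `p` and `q`.
    have h4 : a = (a ^ p) ^ (Int.gcdA p q) * (a ^ q) ^ (Int.gcdB p q) := by
      rw [← zpow_natCast, ← zpow_natCast, ← zpow_mul, ← zpow_mul, ← zpow_add, ← h3]
      simp
    rw [h4]
    exact mul_mem (zpow_mem h1 _) (zpow_mem h2 _)

/-- By base change over `T × T`, the left side is a sum over the sections of `T × T ⟶ T`, that is,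
over the endomorphisms of `T`. These are automorphisms, so all terms agree, and their number is the
mark of `[T]`. -/
lemma markForm_res_tr (hiso : ∀ f : T ⟶ T, IsIso f) (m : N.obj T) (n : N'.obj T) :
    markForm e T (N.res (terminal.from T) (N.tr (terminal.from T) m)) n =
      mark (terminal.from T) (cls (terminal.from T)) * markForm e T m n := by
  have hp := IsPullback.of_hasPullback (terminal.from T) (terminal.from T)
  set p := pullback.fst (terminal.from T) (terminal.from T)
  set q := pullback.snd (terminal.from T) (terminal.from T)
  have := Fintype.ofFinite (Lifts (𝟙 T) q)
  have hs : ∀ s : Lifts (𝟙 T) q, mark s.1 (pairing e _ (N.res p m) (N'.res q n)) =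
      markForm e T m n := by
    intro s
    have := hiso (s.1 ≫ p)
    rw [mark_pairing, ← N.res_comp, ← N'.res_comp, s.2, N'.res_id]
    exact mem_trivialAut e (asIso (s.1 ≫ p)) m n
  rw [N.base_change hp, markForm, pairing_tr_left, mark_tr, Finset.sum_congr rfl fun s _ => hs s,
    Finset.sum_const, Finset.card_univ, nsmul_eq_mul, ← Nat.card_eq_fintype_card,
    Nat.card_congr (liftsPullback hp (𝟙 T)), Category.id_comp, ← mark_cls]

lemma mark_pairing_tr (hiso : ∀ f : T ⟶ T, IsIso f) (m : N.obj T) (n : N'.obj T) :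
    mark (terminal.from T) (pairing e (⊤_ C) (N.tr (terminal.from T) m)
      (N'.tr (terminal.from T) n)) = mark (terminal.from T) (cls (terminal.from T)) *
        (mark (terminal.from T) (cls (terminal.from T)) * markForm e T m n) := by
  rw [mark_pairing, markForm_res_tr e hiso, ← markForm_swap, markForm_res_tr _ hiso, markForm_swap]

end Automorphisms
-- Invertible Mackey functors are free
section Invertible

open PreGaloisCategory

variable {C : Type (u + 1)} [Category.{u} C] [FinitaryExtensive C] [PreGaloisCategory C]
  {N N' : MackeyFunctor C}

/-- A prime ideal of the Burnside ring that is detected by a connected object does not contain all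
products of elements of `N(G/G)` and `N'(G/G)`. -/
lemma Detects.exists_pairing_notMem (e : box N N' ≅ burnside C)
    (Φ : C ⥤ FintypeCat.{u}) [FiberFunctor Φ] {T : C}
    [PreGaloisCategory.IsConnected T] {M : Ideal (BurnsideRing C)} [hp : M.IsPrime]
    (h : Detects T M) : ∃ x y, topEquiv (pairing e (⊤_ C) x y) ∉ M := by
  have : ∀ Y : C, Finite (T ⟶ Y) := fun Y => finite_hom_of_isConnected Φ T Y
  by_contra hc
  push Not at hc
  have hmark : ∀ a : (burnside C).obj (⊤_ C), topEquiv a ∈ M ↔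
      (mark (terminal.from T) a : BurnsideRing C) ∈ M := fun a =>
    ⟨fun ha => (M.sub_mem_iff_right ha).1 (h.sub_mark_mem Φ a),
      fun ha => (M.sub_mem_iff_left ha).1 (h.sub_mark_mem Φ a)⟩
  -- The mark of `[T]` is congruent to `[T]` itself, so it can be cancelled twice from the mark of a
  -- pairing of two transfers.
  have hT : ((mark (terminal.from T) (cls (terminal.from T)) : ℤ) : BurnsideRing C) ∉ M :=
    fun hT => h.notMem ((hmark _).2 hT)
  have hform : ∀ (m : N.obj T) (n : N'.obj T), (markForm e T m n : BurnsideRing C) ∈ M := by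
    intro m n
    have h1 := (hmark _).1 (hc (N.tr (terminal.from T) m) (N'.tr (terminal.from T) n))
    rw [mark_pairing_tr e (isIso_of_endo Φ), Int.cast_mul, Int.cast_mul] at h1
    exact (hp.mem_or_mem ((hp.mem_or_mem h1).resolve_left hT)).resolve_left hT
  -- Marks of the images of box product generators are sums of values of the form, and `e` reaches
  -- `1`, whose mark is `1`.
  have key : ∀ z : (box N N').obj (⊤_ C),
      Ideal.Quotient.mk M (mark (terminal.from T) (e.hom.app _ z) : BurnsideRing C) = 0 := by
    intro z
    refine box_ind ((Ideal.Quotient.mk M).toAddMonoidHom.comp ((Int.castAddHom _).comp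
      ((mark (terminal.from T)).comp (e.hom.app (⊤_ C))))) 0 (fun {X} f m n => ?_) z
    have := Fintype.ofFinite (Lifts (terminal.from T) f)
    refine Ideal.Quotient.eq_zero_iff_mem.2 ?_
    simp only [AddMonoidHom.comp_apply, Int.coe_castAddHom]
    rw [hom_boxMk, mark_tr, Int.cast_sum]
    refine M.sum_mem fun s _ => ?_
    rw [mark_pairing]
    exact hform _ _
  obtain ⟨z, hz⟩ := (app_bijective e (⊤_ C)).2 (cls (𝟙 _))
  have h1 := key z
  rw [hz, mark_one, Int.cast_one, Ideal.Quotient.eq_zero_iff_mem] at h1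
  exact hp.ne_top ((Ideal.eq_top_iff_one M).2 h1)

/-- The pairing at the terminal object as a linear map. -/
def pairingTop (e : box N N' ≅ burnside C) :
    N.obj (⊤_ C) ⊗[BurnsideRing C] N'.obj (⊤_ C) →ₗ[BurnsideRing C] BurnsideRing C :=
  topLin.symm.toLinearMap ∘ₗ appLin e.hom (⊤_ C) ∘ₗ boxPairTop N N'

lemma pairingTop_tmul (e : box N N' ≅ burnside C)
    (x : N.obj (⊤_ C)) (y : N'.obj (⊤_ C)) :
    pairingTop e (x ⊗ₜ y) = topEquiv (pairing e (⊤_ C) x y) := rfl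

/-- The image of the linear pairing is an ideal of the Burnside ring. A maximal ideal containing it
would be detected by a connected object, which is excluded by `Detects.exists_pairing_notMem`. -/
lemma exists_sum_pairing_eq_one (e : box N N' ≅ burnside C)
    (Φ : C ⥤ FintypeCat.{u}) [FiberFunctor Φ] (k : ℕ)
    (hk : ∀ (T : C) [PreGaloisCategory.IsConnected T], Nat.card (Φ.obj T) ≤ k) :
    ∃ S : Finset (N.obj (⊤_ C) × N'.obj (⊤_ C)),
      ∑ i ∈ S, pairing e (⊤_ C) i.1 i.2 = cls (𝟙 _) := by
  have htop : LinearMap.range (pairingTop e) = ⊤ := by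
    by_contra h
    obtain ⟨M, hM, hle⟩ := Ideal.exists_le_maximal (LinearMap.range (pairingTop e)) h
    obtain ⟨T, hT, hd⟩ := exists_detects Φ M hM.ne_top k hk
    have := hM.isPrime
    obtain ⟨x, y, hxy⟩ := hd.exists_pairing_notMem e Φ
    exact hxy (hle ⟨x ⊗ₜ y, pairingTop_tmul e x y⟩)
  obtain ⟨z, hz⟩ := LinearMap.range_eq_top.1 htop 1
  obtain ⟨S, rfl⟩ := TensorProduct.exists_finset z
  refine ⟨S, topEquiv.injective ?_⟩
  rw [topEquiv_one, map_sum, ← hz, map_sum]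
  rfl

/-- If `1` is a sum of products of elements of `N(G/G)` and `N'(G/G)`, then `N` is free. -/
lemma freeCounit_bijective (e : box N N' ≅ burnside C)
    (S : Finset (N.obj (⊤_ C) × N'.obj (⊤_ C)))
    (hS : ∑ i ∈ S, pairing e (⊤_ C) i.1 i.2 = cls (𝟙 _)) (X : C) :
    Function.Bijective ((freeCounit N).app X) := by
  obtain ⟨θ, hθ⟩ := exists_twist e
  -- The twist turns each `⟨n, res yᵢ⟩ res xᵢ` into `θ(⟨res xᵢ, res yᵢ⟩ n)`, and the coefficients
  -- sum to `1`.
  have hsum : ∀ (X : C) (n : N.obj X), ∑ i ∈ S, N.act X (pairing e X n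
      (N'.res (terminal.from X) i.2)) (N.res (terminal.from X) i.1) = θ.hom.app X n := by
    intro X n
    rw [Finset.sum_congr rfl fun i _ => (hθ X n _ _).symm, ← map_sum,
      Finset.sum_congr rfl fun i _ => by rw [← res_pairing], ← AddMonoidHom.finsetSum_apply,
      ← map_sum, ← map_sum, hS, burnside_res_one, one_act]
  let d : N.obj X →+ (freeObj (N.obj (⊤_ C)) : MackeyFunctor C).obj X :=
    ∑ i ∈ S, (AddMonoidHom.mk' (fun a => freeMk a i.1) fun a b => freeMk_add_left a b i.1).comp
      ((pairing e X).flip (N'.res (terminal.from X) i.2))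
  have hd : ∀ n, d n = ∑ i ∈ S, freeMk (pairing e X n (N'.res (terminal.from X) i.2)) i.1 :=
    fun n => AddMonoidHom.finsetSum_apply _ _ _
  constructor
  -- Moving the scalars `⟨x, yᵢ⟩ ∈ A(G)` across the tensor sends `a ⊗ x` to `a ⊗ ∑ ⟨x, yᵢ⟩ xᵢ = a ⊗
  -- θ(x)`. So `d` after the counit is `F(U(θ))`, which is bijective.
  · have hcomp : ∀ w, d ((freeCounit N).app X w) =
        ((F C).mapIso ((U C).mapIso θ)).hom.app X w := by
      refine free_ind (d.comp ((freeCounit N).app X)) _ fun a x => ?_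
      rw [AddMonoidHom.comp_apply, freeCounit_mk, hd]
      have h1 : ∀ i ∈ S, freeMk (pairing e X (N.act X a (N.res (terminal.from X) x))
          (N'.res (terminal.from X) i.2)) i.1 =
          freeMk a (N.act (⊤_ C) (pairing e (⊤_ C) x i.2) i.1) := by
        intro i _
        rw [pairing_act_left, ← res_pairing, ← topEquiv_smul, ← freeMk_smul, act_comm]
        rfl
      have h2 := hsum (⊤_ C) x
      simp only [terminal.hom_ext (terminal.from (⊤_ C)) (𝟙 _), N.res_id, N'.res_id] at h2
      rw [Finset.sum_congr rfl h1]
      let r : N.obj (⊤_ C) →+ (freeObj (N.obj (⊤_ C)) : MackeyFunctor C).obj X :=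
        AddMonoidHom.mk' (fun x => freeMk a x) (freeMk_add_right a)
      exact (map_sum r _ S).symm.trans (congrArg (freeMk a) h2)
    intro w w' h
    apply (app_bijective ((F C).mapIso ((U C).mapIso θ)) X).1
    rw [← hcomp, ← hcomp, h]
  · intro n
    -- The counit after `d` is `θ`, so a preimage under `θ` gives a preimage under the counit.
    obtain ⟨n, rfl⟩ := (app_bijective θ X).2 n
    refine ⟨d n, ?_⟩
    rw [hd, map_sum, ← hsum]
    rfl

/-- The counit of the adjunction between `F` and `U` is an isomorphism at invertible objects. -/
lemma exists_freeIso (e : box N N' ≅ burnside C)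
    (Φ : C ⥤ FintypeCat.{u}) [FiberFunctor Φ] (k : ℕ)
    (hk : ∀ (T : C) [PreGaloisCategory.IsConnected T], Nat.card (Φ.obj T) ≤ k) :
    Nonempty (freeObj (N.obj (⊤_ C)) ≅ N) := by
  obtain ⟨S, hS⟩ := exists_sum_pairing_eq_one e Φ k hk
  exact ⟨isoOfBijective (freeCounit N) (freeCounit_bijective e S hS)⟩

/-- Both `N` and `N'` are free on their values at the terminal object, so `F(N(G/G) ⊗ N'(G/G)) ≅ N □
N' ≅ A ≅ F(A(G))`. Isomorphisms between free Mackey functors descend to the modules. -/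
lemma invertible_top (e : box N N' ≅ burnside C)
    (Φ : C ⥤ FintypeCat.{u}) [FiberFunctor Φ] (k : ℕ)
    (hk : ∀ (T : C) [PreGaloisCategory.IsConnected T], Nat.card (Φ.obj T) ≤ k) :
    Module.Invertible (BurnsideRing C) (N.obj (⊤_ C)) := by
  obtain ⟨i⟩ := exists_freeIso e Φ k hk
  obtain ⟨i'⟩ := exists_freeIso (boxComm N' N ≪≫ e) Φ k hk
  exact .left (linearEquivOfFreeIso
    ((freeBoxIso _ _).symm ≪≫ boxIso i i' ≪≫ e ≪≫ (freeSelfIso C).symm))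

end Invertible

end MackeyFunctor

/-! ### The case of finite `G`-sets -/

lemma FinGSet.card_le_of_isConnected (G : Type u) [Group G] [Finite G] (T : FinGSet G)
    [PreGaloisCategory.IsConnected T] :
    Nat.card ((Action.forget FintypeCat.{u} G).obj T) ≤ Nat.card G := by
  -- A connected `G`-set is a single orbit, hence a quotient of `G`. This is where finiteness of `G`
  -- bounds the fibres.
  have := FintypeCat.Action.pretransitive_of_isConnected G T
  obtain ⟨x⟩ : Nonempty ((Action.forget FintypeCat.{u} G).obj T) := inferInstance
  exact Nat.card_le_card_of_surjective (fun g : G => (g • (show T.V from x) : T.V))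
    (MulAction.exists_smul_eq G (show T.V from x))

end

theorem theoremt (G : Type u) [Group G] [Finite G] :
    Nonempty (MackeyFunctor.F (FinGSet G) ⊣ MackeyFunctor.U (FinGSet G)) ∧
    ∃ e : CommRing.Pic (Burnside G) ≃* PicMack G,
      (∀ (V : ModuleCat.{u + 1} (Burnside G)) [Module.Invertible (Burnside G) V],
        (e (CommRing.Pic.mk (Burnside G) V)).val =
          MackeyFunctor.isoClass ((MackeyFunctor.F (FinGSet G)).obj V)) ∧
      (∀ (x : PicMack G) (N : Mack G), x.val = MackeyFunctor.isoClass N →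
        ∃ _ : Module.Invertible (Burnside G) ((MackeyFunctor.U (FinGSet G)).obj N),
          e.symm x =
            CommRing.Pic.mk (Burnside G) ((MackeyFunctor.U (FinGSet G)).obj N)) := by
  -- This gives surjectivity and, at the same time, identifies the inverse with evaluation at `G/G`.
  have key : ∀ (x : PicMack G) (N : Mack G), x.val = MackeyFunctor.isoClass N →
      ∃ _ : Module.Invertible (Burnside G) ((MackeyFunctor.U (FinGSet G)).obj N),
        MackeyFunctor.picHom (FinGSet G)
          (CommRing.Pic.mk (Burnside G) ((MackeyFunctor.U (FinGSet G)).obj N)) = x.val := by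
    intro x N hx
    obtain ⟨N', hN'⟩ := Quotient.exists_rep x.inv
    have hmul : MackeyFunctor.isoClass (MackeyFunctor.box N N') =
        MackeyFunctor.isoClass (MackeyFunctor.burnside (FinGSet G)) := by
      rw [← MackeyFunctor.isoClass_mul, ← MackeyFunctor.isoClass_one, ← hx]
      exact (congrArg (x.val * ·) hN').trans x.val_inv
    obtain ⟨i⟩ := MackeyFunctor.isoClass_eq_iff.1 hmul
    have hk := fun (T : FinGSet G) [PreGaloisCategory.IsConnected T] =>
      FinGSet.card_le_of_isConnected G T
    have hinv : Module.Invertible (Burnside G) ((MackeyFunctor.U (FinGSet G)).obj N) :=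
      MackeyFunctor.invertible_top i (Action.forget FintypeCat.{u} G) (Nat.card G) hk
    refine ⟨hinv, ?_⟩
    rw [hx]
    exact MackeyFunctor.picHom_mk.trans (MackeyFunctor.isoClass_eq_iff.2
      (MackeyFunctor.exists_freeIso i (Action.forget FintypeCat.{u} G) (Nat.card G) hk))
  -- The source is a group, so `picHom` lands in the units; this is why `F` preserves invertibility.
  have hbij : Function.Bijective (MackeyFunctor.picHom (FinGSet G)).toHomUnits := by
    refine ⟨fun P Q h => MackeyFunctor.picHom_injective (congrArg Units.val h), fun x => ?_⟩
    obtain ⟨N, hN⟩ := Quotient.exists_rep x.val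
    exact (key x N hN.symm).elim fun _ h => ⟨_, Units.ext h⟩
  refine ⟨⟨MackeyFunctor.adjFU (FinGSet G)⟩, MulEquiv.ofBijective _ hbij,
    fun V _ => MackeyFunctor.picHom_mk, fun x N hx => ?_⟩
  obtain ⟨hinv, h⟩ := key x N hx
  exact ⟨hinv, (MulEquiv.symm_apply_eq _).2 (Units.ext h.symm)⟩
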